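/- **Setting.** A team of $N_{\mathcal R}\ge 1$ robots $\mathcal R=\mathcal L\sqcup\mathcal M$ (legitimate and malicious, $|\mathcal L|\ge 1$) moves on a connected undirected graph $\mathcal G$ with at least two sites. The legitimate robots start at arbitrary sites and perform independent lazy random walks: stay with probability $1/2$, otherwise move to a uniformly chosen adjacent site. Given everything that happened before (all sites and all observations so far), each of their moves follows this rule. Malicious robots move arbitrarily, possibly reacting to all that happened before. $T_{\mathrm{hit}}$ is the maximum over pairs of sites $(\iota,\omega)$ of the expected time for a lazy walk started at $\iota$ to reach $\omega$; $T_{\mathrm{meet}}$ is the maximum over pairs of sites of the expected time until two independent lazy walks started there are at the same site. Whenever a legitimate robot $i$ and a robot $j\ne i$ are at the same site at time $t$, robot $i$ obtains a trust observation $\alpha_{i,j}(t)\in[0,1]$. The observations are independent over all pairs and times, those at time $t$ are independent of all sites up to time $t$ and of all earlier observations, and for some $\epsilon_\alpha\in(0,1/2]$ $$\mathbb E[\alpha_{i,j}(t)]\ge \tfrac12+\epsilon_\alpha\ \ (j\in\mathcal L),\qquad \mathbb E[\alpha_{i,j}(t)]\le \tfrac12-\epsilon_\alpha\ \ (j\in\mathcal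 M).$$ **Algorithm (Dynamic Crowd Vetting, window $\tau$, threshold $n_\alpha$).** *Phase 1:* during the time-steps $1,\dots,\tau$ every legitimate robot $i$ collects its observations; let $\eta_{i,j}$ be the number of observations of $j$ and $\beta_{i,j}$ the sum of $\alpha_{i,j}(t)-\frac12$ over them. The interim trust vector has $[\mathbf x_i]_i=1$ and, for $j\neq i$, $[\mathbf x_i]_j=1$ if $\eta_{i,j}\ge n_\alpha$ and $\beta_{i,j}\ge 0$, and $[\mathbf x_i]_j=0$ otherwise. *Phase 2:* the robots move for another $\tau$ steps. Let $\Theta_i$ be the set of robots $j$ with $[\mathbf x_i]_j=1$ that were at the same site as $i$ at some time in $[\tau,2\tau]$ (so $i\in\Theta_i$). Each $j\in\Theta_i$ sends $i$ a $0/1$ vector: its interim trust vector if $j\in\mathcal L$, an arbitrary one if $j\in\mathcal M$. The final trust vector has $[\mathbf x_i^*]_k=1$ if the sum of the received $k$-th entries is at least $|\Theta_i|/2$, and $[\mathbf x^*_i]_k=0$ otherwise. It is *correct* if, for all $k\in\mathcal R$, $[\mathbf x_i^*]_k=1$ exactly when $k\in\mathcal L$. **Theorem 2.** Let $$n_\alpha=\frac{8}{\rho_1\epsilon_\alpha^2}\log\frac1q,\qquad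 q=\frac{\delta\rho_1}{e^{2e}}\frac{|\mathcal L|}{N_{\mathcal R}},\qquad \rho_1=0.1 .$$ For every $\delta_0\in(0,1)$ there is a constant $C$, depending only on $\delta_0$, and for every $K$ a constant $C'_K$, depending only on $\delta_0$ and $K$, such that for all $\mathcal G$, $\epsilon_\alpha\in(0,1/2]$, $\delta\in(0,\delta_0]$, $N_{\mathcal R}$ and $|\mathcal L|$ there is a window length $\tau_0\in\mathbb N$ with total running time $$2\tau_0\le \frac{C}{\epsilon_\alpha^2}\min\Big\{T_{\mathrm{hit}}\log\frac{N_{\mathcal R}}{\delta|\mathcal L|},\ T_{\mathrm{meet}}\log\frac{N_{\mathcal R}}{\delta}\Big\}$$ such that, if all legitimate robots run the algorithm with threshold $n_\alpha$ and any window $\tau\ge\tau_0$, then with probability at least $1-\delta/N_{\mathcal R}$ the final trust vectors of all legitimate robots are correct, whatever the malicious robots report. In particular, the time does not grow with the team size when $|\mathcal M|=O(|\mathcal L|)$: for every $K$ with $|\mathcal M|\le K|\mathcal L|$, the same $\tau_0$ satisfies $2\tau_0\le C'_K\,\epsilon_\alpha^{-2}\,T_{\mathrm{hit}}\log(1/\delta)$.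 -/

import Mathlib

open MeasureTheory ProbabilityTheory
open scoped ENNReal

noncomputable section

namespace CrowdVetting

/-! ### Random walks on the site graph, hitting time and meeting time -/

open Classical in
/-- Transition matrix of the lazy random walk on a graph: stay with probability `1/2`, otherwise
move to a uniformly chosen adjacent (different) site. -/
def lazyWalk {V : Type*} (G : SimpleGraph V) (a b : V) : ℝ :=
  if a = b then 1 / 2
  else if G.Adj a b then 1 / (2 * ((G.neighborSet a).ncard : ℝ)) else 0

open Classical in
/-- Probability that the Markov chain with transition matrix `P` started at `a` is outside `A` at
all times `0, …, t`, i.e. that its first hitting time of `A` exceeds `t`: the sum of the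
probabilities of all such paths of length `t`. -/
def avoidProb {S : Type*} [Fintype S] (P : S → S → ℝ) (a : S) (A : Set S) (t : ℕ) : ℝ :=
  ∑ w : Fin (t + 1) → S,
    if w 0 = a ∧ ∀ s, w s ∉ A then ∏ s : Fin t, P (w s.castSucc) (w s.succ) else 0

/-- Expected first hitting time of `A` from `a`, as `𝔼[T] = ∑_{t ≥ 0} ℙ(T > t)`. -/
def expectedHit {S : Type*} [Fintype S] (P : S → S → ℝ) (a : S) (A : Set S) : ℝ≥0∞ :=
  ∑' t : ℕ, ENNReal.ofReal (avoidProb P a A t)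

/-- Hitting time of the lazy random walk: the maximum over `a, b` of the expected time to
reach `b` from `a`. -/
def hitTime {V : Type*} [Fintype V] (G : SimpleGraph V) : ℝ≥0∞ :=
  ⨆ (a : V) (b : V), expectedHit (lazyWalk G) a {b}

/-- Meeting time: the maximum over `a, b` of the expected time until two independent lazy random
walks started at `a` and `b` are at the same site. -/
def meetTime {V : Type*} [Fintype V] (G : SimpleGraph V) : ℝ≥0∞ :=
  ⨆ (a : V) (b : V),
    expectedHit (fun x y : V × V => lazyWalk G x.1 y.1 * lazyWalk G x.2 y.2) (a, b)
      {x | x.1 = x.2}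

/-! ### The number of observations -/

/-- `ρ₁ = 0.1`. -/
def rho1 : ℝ := 1 / 10

/-- `q = (δ ρ₁ / e^{2e}) · |𝓛| / N`. -/
def qVal (δ : ℝ) (N l : ℕ) : ℝ := δ * rho1 / Real.exp (2 * Real.exp 1) * ((l : ℝ) / (N : ℝ))

/-- `n_α = 8 / (ρ₁ ε²) · log (1 / q)`. -/
def nAlpha (ε δ : ℝ) (N l : ℕ) : ℝ := 8 / (rho1 * ε ^ 2) * Real.log (1 / qVal δ N l)

/-! ### The stochastic model of the team -/

/-- Ordered pairs (legitimate observer, other robot). -/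
abbrev ObsPair {R : Type*} (L : Finset R) : Type _ := {p : R × R // p.1 ∈ L ∧ p.1 ≠ p.2}

/-- The σ-algebra of what happened so far: the sites of all robots (legitimate or malicious) at
times `≤ s`, and the trust observations of the legitimate robots at times `< t`. -/
@[reducible] def record {Ω R V : Type*} (L : Finset R) (χ : ℕ → R → Ω → V) (α : ℕ → R → R → Ω → ℝ)
    (s t : ℕ) : MeasurableSpace Ω :=
  (⨆ r ∈ Set.Iic s, ⨆ i : R, MeasurableSpace.comap (χ r i) ⊤) ⊔
    ⨆ r ∈ Set.Iio t, ⨆ p : ObsPair L,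
      MeasurableSpace.comap (α r p.1.1 p.1.2) (inferInstance : MeasurableSpace ℝ)

/-- `χ t i` is the site of robot `i` at time `t`, and `α t i j` the trust observation that robot
`i` makes of robot `j` at time `t` if they are then at the same site. The legitimate robots are
those in `L`; they start anywhere. Nothing is assumed about the movement of the other robots
except that it does not anticipate the future: they may react to all that happened before. -/
structure IsTeamProcess {Ω R V : Type*} [MeasurableSpace Ω] (μ : Measure Ω)
    (G : SimpleGraph V) (L : Finset R) (ε : ℝ)
    (χ : ℕ → R → Ω → V) (α : ℕ → R → R → Ω → ℝ) : Prop where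
  measurable_site : ∀ t i, Measurable[_, ⊤] (χ t i)
  measurable_obs : ∀ t i j, Measurable (α t i j)
  /-- At every step, given the past (all sites up to time `t`, all observations up to time `t`),
  the legitimate robots move independently of each other by the lazy random walk. -/
  walk : ∀ t (A : Set Ω), MeasurableSet[record L χ α t (t + 1)] A → ∀ v w : R → V,
    μ.real (A ∩ {ω | ∀ i ∈ L, χ t i ω = v i} ∩ {ω | ∀ i ∈ L, χ (t + 1) i ω = w i}) =
      μ.real (A ∩ {ω | ∀ i ∈ L, χ t i ω = v i}) * ∏ i ∈ L, lazyWalk G (v i) (w i)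
  /-- The observations made at the same time are independent. -/
  obs_indep : ∀ t, iIndepFun (fun p : ObsPair L => α t p.1.1 p.1.2) μ
  /-- The observations made at time `t` are independent of the earlier ones, and of all sites
  up to time `t`. -/
  obs_indep_past : ∀ t, Indep (record L χ α t t)
    (⨆ p : ObsPair L,
      MeasurableSpace.comap (α t p.1.1 p.1.2) (inferInstance : MeasurableSpace ℝ)) μ
  obs_range : ∀ t, ∀ i ∈ L, ∀ j, i ≠ j → ∀ᵐ ω ∂μ, α t i j ω ∈ Set.Icc (0 : ℝ) 1
  obs_legit : ∀ t, ∀ i ∈ L, ∀ j ∈ L, i ≠ j → 1 / 2 + ε ≤ ∫ ω, α t i j ω ∂μ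
  obs_malicious : ∀ t, ∀ i ∈ L, ∀ j ∉ L, ∫ ω, α t i j ω ∂μ ≤ 1 / 2 - ε

/-! ### The algorithm

Below, `χ : ℕ → R → V` and `α : ℕ → R → R → ℝ` are one realisation of the sites and of the
observations. Time `0` is the start; phase 1 consists of the steps `1, …, τ`, and phase 2 of the
steps `τ + 1, …, 2 τ`. -/

section Algorithm

variable {R V : Type*} [Fintype R] [DecidableEq R] [DecidableEq V]

/-- The neighborhood of robot `i` at time `t`: the robots at the same site, `i` included. -/
def neighbors (χ : ℕ → R → V) (t : ℕ) (i : R) : Finset R :=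
  Finset.univ.filter fun j => χ t j = χ t i

/-- The time-window neighborhood: the robots met at some time in `[t - T, t]`. -/
def windowNeighbors (χ : ℕ → R → V) (T t : ℕ) (i : R) : Finset R :=
  (Finset.Icc (t - T) t).biUnion fun s => neighbors χ s i

/-- The times in phase 1 at which robot `i` observes robot `j`. -/
def obsTimes (χ : ℕ → R → V) (τ : ℕ) (i j : R) : Finset ℕ :=
  (Finset.Icc 1 τ).filter fun t => j ∈ neighbors χ t i

/-- The trust function `β_{i,j}` after phase 1. -/
def trustFn (χ : ℕ → R → V) (α : ℕ → R → R → ℝ) (τ : ℕ) (i j : R) : ℝ :=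
  ∑ t ∈ obsTimes χ τ i j, (α t i j - 1 / 2)

open Classical in
/-- The interim trust vector `x_i` (Individual Protocol run for `τ` steps with `n` observations). -/
def interim (χ : ℕ → R → V) (α : ℕ → R → R → ℝ) (τ : ℕ) (n : ℝ) (i j : R) : Bool :=
  decide (j = i ∨ (n ≤ ((obsTimes χ τ i j).card : ℝ) ∧ 0 ≤ trustFn χ α τ i j))

/-- The trusted neighborhood of robot `i` in phase 2. -/
def trusted (χ : ℕ → R → V) (α : ℕ → R → R → ℝ) (τ : ℕ) (n : ℝ) (i : R) : Finset R :=
  (windowNeighbors χ τ (2 * τ) i).filter fun j => interim χ α τ n i j = true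

/-- What robot `i` is told by robot `j` about robot `k`: a legitimate robot shares its interim
trust vector, a malicious one sends an arbitrary opinion `rep i j k`. -/
def shared (L : Finset R) (χ : ℕ → R → V) (α : ℕ → R → R → ℝ) (τ : ℕ) (n : ℝ)
    (rep : R → R → R → Bool) (i j k : R) : Bool :=
  if j ∈ L then interim χ α τ n j k else rep i j k

open Classical in
/-- The final trust vector `x_i^*` of the Dynamic Crowd Vetting algorithm: majority rule over the
trusted neighborhood. -/
def finalTrust (L : Finset R) (χ : ℕ → R → V) (α : ℕ → R → R → ℝ) (τ : ℕ) (n : ℝ)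
    (rep : R → R → R → Bool) (i k : R) : Bool :=
  decide (((trusted χ α τ n i).card : ℝ) / 2 ≤
    ∑ j ∈ trusted χ α τ n i, if shared L χ α τ n rep i j k = true then (1 : ℝ) else 0)

end Algorithm

end CrowdVetting

end

/-!
Let `q = r * l` with `r = δ / (10 e^(2e) N)`, where `N` is the number of robots and `l` the number of
legitimate ones. The vote of robot `i` about robot `k` can only go wrong if at least `l / 8` robots
fail in one of five ways: a legitimate robot meets `i` (or `k`) fewer than `n_α` times in phase 1,
or does not meet `i` in phase 2, or is misjudged by `i`; a malicious robot is misjudged by `i`; `k` is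
misjudged by a legitimate robot (`finalTrust_correct`). It suffices that each way has
probability at most `r ^ 3`.

*Observations.* For any set `J` of pairs, `∏ exp (2 ε² η - 4 ε β)` (with the sign of `β` reversed for
malicious robots) has mean at most `1` by Hoeffding's lemma, as the observations at time `t` are
independent of each other and of the past, including the sites at time `t`. Hence all pairs in
`J` misjudge with probability at most `(q ^ 160) ^ J.card` (`measure_misjudge_le`). The union bound
over the sets `J` of `m = ⌈l / 8⌉` pairs costs a binomial coefficient, which `q ^ m` pays for, and
`q ^ (24 m) ≤ r ^ 3` remains (`choose_mul_pow_le`).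

*Meetings, in the time scale of the hitting time.* Given the path of `i`, the other legitimate robots
are independent lazy walks which have to hit a moving target (`weightMean_eq_pathMean`). A lazy walk
mixes in a time of order `T_hit` (`mixing`), and from its stationary distribution it
avoids a moving target during `s` steps with probability at most `(1 - 1 / T_hit) ^ s`
(`stationary_avoid_le`). So in each window of order `T_hit` there is a hit with probability at
least `1 / 4`, whatever happened before, and `8 n_α` windows yield `n_α` meetings up to a failure
probability of `q ^ 25`, independently for the different robots.

*Meetings, in the time scale of the meeting time.* By Markov's inequality two given robots meet in a
window of length `2 T_meet` with probability at least `1 / 2`. Different pairs need not be independent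
here, and a union bound over the pairs requires a failure probability in terms of `r` in place of
`q`, which turns `log (N / (δ l))` into `log (N / δ)`.
-/

namespace CrowdVetting

/-! ### Finite Markov chains: hitting times and weighted hit counts -/

section Chain

variable {S : Type*} [Fintype S]

/-- The Markov operator of the transition matrix `P`: the mean of `f` after one step. -/
def avg (P : S → S → ℝ) (f : S → ℝ) (x : S) : ℝ := ∑ y, P x y * f y

/-- `P` is a stochastic matrix. -/
structure IsStochastic (P : S → S → ℝ) : Prop where
  nonneg : ∀ x y, 0 ≤ P x y
  sum_eq_one : ∀ x, ∑ y, P x y = 1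

lemma avg_const_mul (P : S → S → ℝ) (c : ℝ) (f : S → ℝ) (x : S) :
    avg P (fun y => c * f y) x = c * avg P f x := by
  simp only [avg, Finset.mul_sum]
  exact Finset.sum_congr rfl fun y _ => by ring

lemma avg_add (P : S → S → ℝ) (f g : S → ℝ) (x : S) :
    avg P (fun y => f y + g y) x = avg P f x + avg P g x := by
  simp only [avg, mul_add, Finset.sum_add_distrib]

namespace IsStochastic

variable {P : S → S → ℝ} (hP : IsStochastic P)
include hP

lemma avg_mono {f g : S → ℝ} (h : ∀ y, f y ≤ g y) (x : S) : avg P f x ≤ avg P g x :=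
  Finset.sum_le_sum fun y _ => mul_le_mul_of_nonneg_left (h y) (hP.nonneg x y)

lemma avg_const (c : ℝ) (x : S) : avg P (fun _ => c) x = c := by
  simp [avg, ← Finset.sum_mul, hP.sum_eq_one]

lemma avg_le {f : S → ℝ} {c : ℝ} (h : ∀ y, f y ≤ c) (x : S) : avg P f x ≤ c :=
  (hP.avg_mono h x).trans_eq (hP.avg_const c x)

lemma avg_nonneg {f : S → ℝ} (h : ∀ y, 0 ≤ f y) (x : S) : 0 ≤ avg P f x :=
  Finset.sum_nonneg fun y _ => mul_nonneg (hP.nonneg x y) (h y)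

end IsStochastic

open Classical in
/-- The probability `ℙ_x(T_A > n)` that the chain started at `x` is outside `A` at the times
`0, …, n`, by first-step recursion. -/
noncomputable def avoid (P : S → S → ℝ) (A : Set S) : ℕ → S → ℝ
  | 0, x => if x ∈ A then 0 else 1
  | n + 1, x => if x ∈ A then 0 else avg P (avoid P A n) x

/-- The sum over paths in `avoidProb` satisfies the first-step recursion. -/
lemma avoidProb_eq_avoid (P : S → S → ℝ) (A : Set S) (n : ℕ) (x : S) :
    avoidProb P x A n = avoid P A n x := by
  classical
  induction n generalizing x with
  | zero =>
    unfold avoidProb avoid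
    rw [← Equiv.sum_comp (Equiv.funUnique (Fin 1) S).symm, Finset.sum_eq_single x]
    · by_cases hx : x ∈ A <;> simp [hx]
    · intro b _ hb
      simp [hb]
    · simp
  | succ n ih =>
    have key : avoidProb P x A (n + 1) = if x ∈ A then 0 else
        ∑ w : Fin (n + 1) → S, if ∀ s, w s ∉ A then
          P x (w 0) * ∏ s : Fin n, P (w s.castSucc) (w s.succ) else 0 := by
      unfold avoidProb
      rw [← (Fin.consEquiv fun _ : Fin (n + 2) => S).sum_comp, Fintype.sum_prod_type,
        Finset.sum_eq_single x]
      · split_ifs with hx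
        · refine Finset.sum_eq_zero fun w _ => if_neg fun h => ?_
          exact h.2 0 (by simpa using hx)
        · refine Finset.sum_congr rfl fun w _ => ?_
          simp only [Fin.consEquiv, Equiv.coe_fn_mk, Fin.cons_zero, true_and, Fin.forall_fin_succ,
            Fin.cons_succ, hx, not_false_eq_true, Fin.prod_univ_succ, Fin.castSucc_zero,
            ← Fin.succ_castSucc]
      · intro b _ hb
        refine Finset.sum_eq_zero fun w _ => if_neg fun h => hb ?_
        simpa using h.1
      · simp
    rw [key, avoid]
    split_ifs with hx
    · rfl
    · simp only [avg, ← ih]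
      simp only [avoidProb, Finset.mul_sum]
      rw [Finset.sum_comm]
      refine Finset.sum_congr rfl fun w _ => ?_
      rw [Finset.sum_eq_single (w 0)]
      · simp
      · intro b _ hb
        rw [if_neg, mul_zero]
        exact fun h => hb h.1.symm
      · simp

lemma avoid_of_mem (P : S → S → ℝ) {A : Set S} {x : S} (hx : x ∈ A) (n : ℕ) :
    avoid P A n x = 0 := by
  cases n <;> simp [avoid, hx]

namespace IsStochastic

variable {P : S → S → ℝ} (hP : IsStochastic P)
include hP

lemma avoid_nonneg (A : Set S) (n : ℕ) (x : S) : 0 ≤ avoid P A n x := by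
  induction n generalizing x with
  | zero => unfold avoid; split_ifs <;> norm_num
  | succ n ih => unfold avoid; split_ifs; exacts [le_rfl, hP.avg_nonneg ih x]

lemma avoid_add_le (A : Set S) {n : ℕ} {b : ℝ} (hb : ∀ x, avoid P A n x ≤ b) (m : ℕ) (x : S) :
    avoid P A (m + n) x ≤ b * avoid P A m x := by
  induction m generalizing x with
  | zero =>
    by_cases hx : x ∈ A
    · simp [avoid_of_mem P hx]
    · simpa [avoid, hx] using hb x
  | succ m ih =>
    by_cases hx : x ∈ A
    · simp [avoid_of_mem P hx]
    · rw [Nat.add_right_comm]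
      simp only [avoid, hx, if_false]
      rw [← avg_const_mul]
      exact hP.avg_mono ih x

lemma avoid_le_one (A : Set S) (n : ℕ) (x : S) : avoid P A n x ≤ 1 := by
  induction n generalizing x with
  | zero => unfold avoid; split_ifs <;> norm_num
  | succ n ih => unfold avoid; split_ifs; exacts [zero_le_one, hP.avg_le ih x]

lemma avoid_antitone (A : Set S) (x : S) : Antitone fun n => avoid P A n x :=
  antitone_nat_of_succ_le fun n => by
    simpa using hP.avoid_add_le A (hP.avoid_le_one A 1) n x

lemma ofReal_sum_avoid_le (A : Set S) (n : ℕ) (x : S) :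
    ENNReal.ofReal (∑ t ∈ Finset.range n, avoid P A t x) ≤ expectedHit P x A := by
  rw [ENNReal.ofReal_sum_of_nonneg fun t _ => hP.avoid_nonneg A t x, expectedHit]
  simp only [avoidProb_eq_avoid]
  exact ENNReal.sum_le_tsum _

/-- The mean hitting time is finite if from every state there is a positive probability to
reach `A`. -/
lemma expectedHit_lt_top (A : Set S) (h : ∀ x, ∃ n, avoid P A n x < 1) (x : S) :
    expectedHit P x A < ∞ := by
  choose n hn using h
  set N := ∑ y, n y
  have hN : ∀ y, avoid P A N y < 1 := fun y =>
    (hP.avoid_antitone A y (Finset.single_le_sum (fun _ _ => Nat.zero_le _)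
      (Finset.mem_univ y))).trans_lt (hn y)
  obtain ⟨z, -, hz⟩ := Finset.exists_max_image Finset.univ (avoid P A N) ⟨x, Finset.mem_univ x⟩
  set b := avoid P A N z
  have hb : ∀ y, avoid P A N y ≤ b := fun y => hz y (Finset.mem_univ y)
  have hb1 : b < 1 := hN z
  -- the tail after time `N` is at most `b` times the whole sum
  have hsum : ∀ k, ∑ t ∈ Finset.range k, avoid P A t x ≤ N / (1 - b) := by
    intro k
    rw [le_div_iff₀ (by linarith)]
    have h1 : ∑ t ∈ Finset.range k, avoid P A t x ≤
        ∑ t ∈ Finset.range (N + k), avoid P A t x :=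
      Finset.sum_le_sum_of_subset_of_nonneg (Finset.range_mono (by omega))
        fun t _ _ => hP.avoid_nonneg A t x
    rw [Finset.sum_range_add] at h1
    have h2 : ∑ t ∈ Finset.range N, avoid P A t x ≤ N := by
      simpa using Finset.sum_le_sum fun t (_ : t ∈ Finset.range N) => hP.avoid_le_one A t x
    have h3 : ∑ t ∈ Finset.range k, avoid P A (N + t) x ≤
        b * ∑ t ∈ Finset.range k, avoid P A t x := by
      rw [Finset.mul_sum]
      refine Finset.sum_le_sum fun t _ => ?_
      rw [add_comm]
      exact hP.avoid_add_le A hb t x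
    linarith
  refine lt_of_le_of_lt ?_ (ENNReal.ofReal_lt_top (r := N / (1 - b)))
  simp only [expectedHit, avoidProb_eq_avoid]
  rw [ENNReal.tsum_eq_iSup_nat]
  refine iSup_le fun k => ?_
  rw [← ENNReal.ofReal_sum_of_nonneg fun t _ => hP.avoid_nonneg A t x]
  exact ENNReal.ofReal_le_ofReal (hsum k)

lemma avoid_lt_one_of_step (A : Set S) {x y : S} (hxy : 0 < P x y) {n : ℕ}
    (hn : avoid P A n y < 1) : avoid P A (n + 1) x < 1 := by
  by_cases hx : x ∈ A
  · simp [avoid_of_mem P hx]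
  · simp only [avoid, hx, if_false]
    rw [← hP.sum_eq_one x]
    refine Finset.sum_lt_sum (fun z _ => ?_) ⟨y, Finset.mem_univ y, ?_⟩
    · exact mul_le_of_le_one_right (hP.nonneg x z) (hP.avoid_le_one A n z)
    · exact mul_lt_of_lt_one_right hxy hn

/-- Finite mean hitting times solve the first-step equations. -/
lemma toReal_expectedHit (A : Set S) (hfin : ∀ x, expectedHit P x A < ∞) {x : S} (hx : x ∉ A) :
    (expectedHit P x A).toReal = 1 + avg P (fun y => (expectedHit P y A).toReal) x := by
  have hs : ∀ y, Summable fun n => avoid P A n y := by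
    intro y
    have h := (hfin y).ne
    simp only [expectedHit, avoidProb_eq_avoid] at h
    have := ENNReal.summable_toReal h
    simpa only [ENNReal.toReal_ofReal (hP.avoid_nonneg A _ y)] using this
  have ht : ∀ y, (expectedHit P y A).toReal = ∑' n, avoid P A n y := by
    intro y
    simp only [expectedHit, avoidProb_eq_avoid]
    rw [ENNReal.tsum_toReal_eq fun _ => ENNReal.ofReal_ne_top]
    simp only [ENNReal.toReal_ofReal (hP.avoid_nonneg A _ y)]
  rw [ht, (hs x).tsum_eq_zero_add]
  simp only [avoid, hx, if_false, avg, ht]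
  rw [Summable.tsum_finsetSum fun y _ => (hs y).mul_left _]
  simp only [tsum_mul_left]

lemma one_le_expectedHit (A : Set S) {x : S} (hx : x ∉ A) : 1 ≤ expectedHit P x A := by
  simpa [avoid, hx] using hP.ofReal_sum_avoid_le A 1 x

/-- Markov's inequality for the hitting time. -/
lemma avoid_le_div (A : Set S) {T : ℝ} {x : S} (hT : 0 ≤ T)
    (h : expectedHit P x A ≤ ENNReal.ofReal T) (n : ℕ) : avoid P A n x ≤ T / (n + 1) := by
  have h1 := (ENNReal.ofReal_le_ofReal_iff hT).1 ((hP.ofReal_sum_avoid_le A (n + 1) x).trans h)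
  have h2 : (n + 1 : ℕ) • avoid P A n x ≤ ∑ t ∈ Finset.range (n + 1), avoid P A t x := by
    simpa using Finset.card_nsmul_le_sum (Finset.range (n + 1)) (fun t => avoid P A t x) _
      fun t ht => hP.avoid_antitone A x (Nat.lt_succ_iff.1 (Finset.mem_range.1 ht))
  rw [le_div_iff₀ (by positivity)]
  rw [nsmul_eq_mul] at h2
  push_cast at h2
  linarith

end IsStochastic

open Classical in
/-- The mean of `θ ^ #{s ∈ {1, …, t} | X_s ∈ A_s} * φ (X_t)` for the chain `X` started at `x`,
where `[A_1, …, A_t]` is the given list of moving targets. -/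
noncomputable def hitMean (P : S → S → ℝ) (θ : ℝ) : List (Set S) → (S → ℝ) → S → ℝ
  | [], φ => φ
  | A :: h, φ => avg P fun y => (if y ∈ A then θ else 1) * hitMean P θ h φ y

lemma hitMean_append (P : S → S → ℝ) (θ : ℝ) (h₁ h₂ : List (Set S)) (φ : S → ℝ) :
    hitMean P θ (h₁ ++ h₂) φ = hitMean P θ h₁ (hitMean P θ h₂ φ) := by
  induction h₁ with
  | nil => rfl
  | cons A h ih => simp only [List.cons_append, hitMean, ih]

lemma hitMean_const_mul (P : S → S → ℝ) (θ c : ℝ) (h : List (Set S)) (φ : S → ℝ) (x : S) :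
    hitMean P θ h (fun y => c * φ y) x = c * hitMean P θ h φ x := by
  induction h generalizing x with
  | nil => rfl
  | cons A h ih =>
    simp only [hitMean, ih]
    rw [← avg_const_mul]
    congr 1
    ext y
    ring

lemma hitMean_zero_replicate (P : S → S → ℝ) (A : Set S) (n : ℕ) (x : S) :
    hitMean P 0 (List.replicate (n + 1) A) (fun _ => 1) x = avg P (avoid P A n) x := by
  classical
  induction n generalizing x with
  | zero =>
    simp only [List.replicate, hitMean, mul_one]
    congr 1
  | succ n ih =>
    rw [List.replicate_succ, hitMean]
    congr 1
    ext y
    rw [ih, avoid]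
    split_ifs <;> simp

namespace IsStochastic

variable {P : S → S → ℝ} (hP : IsStochastic P)
include hP

lemma hitMean_mono {θ : ℝ} (hθ : 0 ≤ θ) (h : List (Set S)) {φ ψ : S → ℝ} (hφ : ∀ y, φ y ≤ ψ y)
    (x : S) : hitMean P θ h φ x ≤ hitMean P θ h ψ x := by
  induction h generalizing x with
  | nil => exact hφ x
  | cons A h ih =>
    refine hP.avg_mono (fun y => mul_le_mul_of_nonneg_left (ih y) ?_) x
    split_ifs; exacts [hθ, zero_le_one]

lemma hitMean_nonneg {θ : ℝ} (hθ : 0 ≤ θ) (h : List (Set S)) {φ : S → ℝ} (hφ : ∀ y, 0 ≤ φ y)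
    (x : S) : 0 ≤ hitMean P θ h φ x := by
  induction h generalizing x with
  | nil => exact hφ x
  | cons A h ih =>
    refine hP.avg_nonneg (fun y => mul_nonneg ?_ (ih y)) x
    split_ifs; exacts [hθ, zero_le_one]

/-- Targets may be dropped. -/
lemma hitMean_le_iterate {θ : ℝ} (hθ : 0 ≤ θ) (hθ1 : θ ≤ 1) (h : List (Set S)) {φ : S → ℝ}
    (hφ : ∀ y, 0 ≤ φ y) (x : S) : hitMean P θ h φ x ≤ (avg P)^[h.length] φ x := by
  induction h generalizing x with
  | nil => exact le_rfl
  | cons A h ih =>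
    rw [List.length_cons, Function.iterate_succ_apply']
    refine hP.avg_mono (fun y => le_trans ?_ (ih y)) x
    refine mul_le_of_le_one_left (hP.hitMean_nonneg hθ h hφ y) ?_
    split_ifs; exacts [hθ1, le_rfl]

lemma hitMean_one_le_one {θ : ℝ} (hθ : 0 ≤ θ) (hθ1 : θ ≤ 1) (h : List (Set S)) (x : S) :
    hitMean P θ h (fun _ => 1) x ≤ 1 := by
  induction h generalizing x with
  | nil => exact le_rfl
  | cons A h ih =>
    refine hP.avg_le (fun y => mul_le_one₀ ?_ (hP.hitMean_nonneg hθ h (fun _ => zero_le_one) y)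
      (ih y)) x
    split_ifs; exacts [hθ1, le_rfl]

/-- At least one hit occurs unless all targets are avoided. -/
lemma hitMean_le_avoid {θ : ℝ} (hθ : 0 ≤ θ) (hθ1 : θ ≤ 1) (h : List (Set S)) (x : S) :
    hitMean P θ h (fun _ => 1) x ≤ θ + (1 - θ) * hitMean P 0 h (fun _ => 1) x := by
  classical
  induction h generalizing x with
  | nil => simp [hitMean]
  | cons A h ih =>
    simp only [hitMean]
    rw [← avg_const_mul]
    refine le_of_le_of_eq ?_ (congrArg (· + avg P (fun y => (1 - θ) *
      ((if y ∈ A then 0 else 1) * hitMean P 0 h (fun _ => 1) y)) x) (hP.avg_const θ x))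
    rw [← avg_add]
    refine hP.avg_mono (fun y => ?_) x
    split_ifs
    · have := hP.hitMean_one_le_one hθ hθ1 h y
      nlinarith
    · simpa using ih y

/-- A bound for every window of `W` steps multiplies over `w` successive windows. -/
lemma hitMean_le_pow {θ c : ℝ} (hθ : 0 ≤ θ) (hc : 0 ≤ c) (Q : Set S → Prop) (W : ℕ)
    (hW : ∀ h : List (Set S), (∀ A ∈ h, Q A) → h.length = W →
      ∀ x, hitMean P θ h (fun _ => 1) x ≤ c)
    (w : ℕ) (h : List (Set S)) (hQ : ∀ A ∈ h, Q A) (hl : h.length = W * w) (x : S) :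
    hitMean P θ h (fun _ => 1) x ≤ c ^ w := by
  induction w generalizing h x with
  | zero =>
    rw [mul_zero, List.length_eq_zero_iff] at hl
    simp [hl, hitMean]
  | succ w ih =>
    rw [← List.take_append_drop W h, hitMean_append]
    have hd : ∀ y, hitMean P θ (h.drop W) (fun _ => 1) y ≤ c ^ w * 1 := fun y => by
      rw [mul_one]
      refine ih _ (fun A hA => hQ A (List.mem_of_mem_drop hA)) ?_ y
      rw [List.length_drop, hl, Nat.mul_succ]
      omega
    refine (hP.hitMean_mono hθ _ hd x).trans ?_
    rw [hitMean_const_mul, pow_succ]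
    refine mul_le_mul_of_nonneg_left (hW _ (fun A hA => hQ A (List.mem_of_mem_take hA)) ?_ x)
      (pow_nonneg hc w)
    rw [List.length_take, hl, Nat.mul_succ]
    omega

end IsStochastic

end Chain

/-! ### Reversible chains: mixing and moving targets -/

section Reversible

variable {S : Type*} [Fintype S]

/-- The inner product of `ℓ²(p)`. -/
def wInner (p f g : S → ℝ) : ℝ := ∑ x, p x * (f x * g x)

/-- `P` is reversible with respect to the positive probability vector `p`, and the
form `⟨f, P f⟩` is positive semidefinite, as is the case for lazy chains. -/
structure IsReversible (P : S → S → ℝ) (p : S → ℝ) : Prop extends IsStochastic P where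
  weight_pos : ∀ x, 0 < p x
  weight_sum : ∑ x, p x = 1
  detailed_balance : ∀ x y, p x * P x y = p y * P y x
  psd : ∀ f, 0 ≤ wInner p f (avg P f)

lemma wInner_comm (p f g : S → ℝ) : wInner p f g = wInner p g f :=
  Finset.sum_congr rfl fun x _ => by ring

lemma wInner_add_smul (p f g k : S → ℝ) (t : ℝ) :
    wInner p (fun x => f x + t * g x) k = wInner p f k + t * wInner p g k := by
  simp only [wInner, Finset.mul_sum, ← Finset.sum_add_distrib]
  exact Finset.sum_congr rfl fun x _ => by ring

lemma avg_add_smul (P : S → S → ℝ) (f g : S → ℝ) (t : ℝ) :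
    avg P (fun x => f x + t * g x) = fun x => avg P f x + t * avg P g x := by
  ext x
  rw [avg_add, avg_const_mul]

namespace IsReversible

variable {P : S → S → ℝ} {p : S → ℝ} (hP : IsReversible P p)
include hP

lemma wInner_avg (f g : S → ℝ) : wInner p f (avg P g) = wInner p (avg P f) g := by
  simp only [wInner, avg, Finset.mul_sum, Finset.sum_mul]
  rw [Finset.sum_comm]
  refine Finset.sum_congr rfl fun y _ => Finset.sum_congr rfl fun x _ => ?_
  linear_combination (f x * g y) * hP.detailed_balance x y

lemma wInner_iterate (n : ℕ) (f g : S → ℝ) :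
    wInner p f ((avg P)^[n] g) = wInner p ((avg P)^[n] f) g := by
  induction n generalizing f g with
  | zero => rfl
  | succ n ih => rw [Function.iterate_succ_apply', hP.wInner_avg, ih, Function.iterate_succ_apply]

lemma wInner_self_nonneg (f : S → ℝ) : 0 ≤ wInner p f f :=
  Finset.sum_nonneg fun x _ => mul_nonneg (hP.weight_pos x).le (mul_self_nonneg _)

lemma wInner_sq_le (f g : S → ℝ) : wInner p f g ^ 2 ≤ wInner p f f * wInner p g g :=
  Finset.sum_sq_le_sum_mul_sum_of_sq_le_mul _
    (fun x _ => mul_nonneg (hP.weight_pos x).le (mul_self_nonneg _))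
    (fun x _ => mul_nonneg (hP.weight_pos x).le (mul_self_nonneg _)) fun x _ => le_of_eq (by ring)

/-- Cauchy–Schwarz for the positive semidefinite form `⟨f, P g⟩`. -/
lemma wInner_avg_sq_le (f g : S → ℝ) :
    wInner p f (avg P g) ^ 2 ≤ wInner p f (avg P f) * wInner p g (avg P g) := by
  have h : ∀ t : ℝ, 0 ≤ wInner p g (avg P g) * (t * t) + 2 * wInner p f (avg P g) * t +
      wInner p f (avg P f) := by
    intro t
    have h1 := hP.psd fun x => f x + t * g x
    rw [avg_add_smul, wInner_add_smul, wInner_comm p f, wInner_comm p g, wInner_add_smul,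
      wInner_add_smul, wInner_comm p (avg P f) g, wInner_comm p (avg P g) f, hP.wInner_avg g f,
      wInner_comm p (avg P g) f, wInner_comm p (avg P f) f, wInner_comm p (avg P g) g] at h1
    linarith
  have := discrim_le_zero h
  rw [discrim] at this
  linarith

/-- Schur's test: a positive function with `P h ≤ c * h` on the support of `f` bounds the form
`⟨f, P f⟩` by `c * ⟨f, f⟩`. -/
lemma wInner_avg_self_le {c : ℝ} {f h : S → ℝ} (h0 : ∀ x, 0 ≤ h x)
    (hf : ∀ x, f x ≠ 0 → 0 < h x ∧ avg P h x ≤ c * h x) :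
    wInner p f (avg P f) ≤ c * wInner p f f := by
  have h1 : wInner p f (avg P f) ≤
      ∑ x, ∑ y, (p x * P x y * (f x ^ 2 * h y / h x) + p y * P y x * (f y ^ 2 * h x / h y)) / 2 := by
    simp only [wInner, avg, Finset.mul_sum]
    refine Finset.sum_le_sum fun x _ => Finset.sum_le_sum fun y _ => ?_
    rw [← hP.detailed_balance x y, ← mul_add, mul_div_assoc]
    have hq : 0 ≤ p x * P x y := mul_nonneg (hP.weight_pos x).le (hP.nonneg x y)
    suffices f x * f y ≤ (f x ^ 2 * h y / h x + f y ^ 2 * h x / h y) / 2 by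
      calc p x * (f x * (P x y * f y)) = p x * P x y * (f x * f y) := by ring
        _ ≤ _ := mul_le_mul_of_nonneg_left this hq
    have hnn : 0 ≤ (f x ^ 2 * h y / h x + f y ^ 2 * h x / h y) / 2 := by
      have := h0 x
      have := h0 y
      positivity
    by_cases hx : f x = 0
    · simpa [hx] using hnn
    by_cases hy : f y = 0
    · simpa [hy] using hnn
    have hx' := (hf x hx).1
    have hy' := (hf y hy).1
    rw [div_add_div _ _ hx'.ne' hy'.ne', div_div, le_div_iff₀ (by positivity)]
    nlinarith [sq_nonneg (f x * h y - f y * h x)]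
  have h2 : ∑ x, ∑ y, (p x * P x y * (f x ^ 2 * h y / h x) +
      p y * P y x * (f y ^ 2 * h x / h y)) / 2 = ∑ x, p x * (f x ^ 2 / h x * avg P h x) := by
    simp only [add_div, Finset.sum_add_distrib]
    rw [Finset.sum_comm (f := fun x y => p y * P y x * (f y ^ 2 * h x / h y) / 2),
      ← Finset.sum_add_distrib]
    refine Finset.sum_congr rfl fun x _ => ?_
    rw [← Finset.sum_add_distrib, avg, Finset.mul_sum, Finset.mul_sum]
    refine Finset.sum_congr rfl fun y _ => ?_
    ring
  rw [h2] at h1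
  refine h1.trans ?_
  rw [wInner, Finset.mul_sum]
  refine Finset.sum_le_sum fun x _ => ?_
  by_cases hx : f x = 0
  · simp [hx]
  obtain ⟨hx1, hx2⟩ := hf x hx
  have : f x ^ 2 / h x * avg P h x ≤ f x ^ 2 / h x * (c * h x) :=
    mul_le_mul_of_nonneg_left hx2 (by positivity)
  have e : f x ^ 2 / h x * (c * h x) = c * (f x * f x) := by field_simp
  nlinarith [hP.weight_pos x]

lemma wInner_avg_avg_le (f : S → ℝ) : wInner p (avg P f) (avg P f) ≤ wInner p f f := by
  have hle : ∀ g : S → ℝ, wInner p g (avg P g) ≤ wInner p g g := fun g => by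
    simpa using hP.wInner_avg_self_le (c := 1) (f := g) (h := fun _ => 1)
      (fun _ => zero_le_one) fun x _ => ⟨zero_lt_one, by simp [hP.avg_const]⟩
  have h1 := hP.wInner_avg_sq_le (avg P f) f
  have h2 := mul_le_mul (hle (avg P f)) (hle f) (hP.psd f) (hP.wInner_self_nonneg _)
  have h3 := hP.wInner_self_nonneg (avg P f)
  have h4 := hP.wInner_self_nonneg f
  rcases h3.eq_or_lt with h | h
  · rw [← h]; exact h4
  · nlinarith

lemma wInner_one_iterate (n : ℕ) (f : S → ℝ) :
    ∑ x, p x * (avg P)^[n] f x = ∑ x, p x * f x := by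
  have h1 : (avg P)^[n] (fun _ => (1 : ℝ)) = fun _ => 1 := by
    induction n with
    | zero => rfl
    | succ n ih => rw [Function.iterate_succ_apply', ih]; ext x; exact hP.avg_const 1 x
  have := hP.wInner_iterate n (fun _ => 1) f
  rw [h1] at this
  simpa [wInner] using this

lemma iterate_le {f : S → ℝ} {c : ℝ} (hf : ∀ x, f x ≤ c) (n : ℕ) (x : S) :
    (avg P)^[n] f x ≤ c := by
  induction n generalizing x with
  | zero => exact hf x
  | succ n ih => rw [Function.iterate_succ_apply']; exact hP.avg_le ih x

/-- Mixing in the time scale of hitting times. If `h` is the mean hitting time of `x`, then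
`P h = h + f` with `f = δ_x / p x - 1`, hence `∑_{u < n} ⟨f, P ^ u f⟩ = (P ^ n h) x ≤ T`. The summands
of even index are `‖P ^ k f‖²`, which decreases in `k`, and the others are nonnegative. -/
lemma mixing {T : ℝ} {h : S → ℝ} {x : S} (h0 : ∀ y, 0 ≤ h y) (hT : ∀ y, h y ≤ T)
    (hh : ∀ y, y ≠ x → avg P h y = h y - 1) {φ : S → ℝ} (φ0 : ∀ y, 0 ≤ φ y) (φ1 : ∀ y, φ y ≤ 1)
    {n : ℕ} (hn : 16 * T ≤ n) (hn0 : 0 < n) :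
    (avg P)^[n] φ x ≤ ∑ y, p y * φ y + 1 / 4 := by
  classical
  set f : S → ℝ := fun y => (if y = x then 1 / p x else 0) - 1 with hfdef
  -- pairing with `f` evaluates at `x` and centers
  have hfi : ∀ g : S → ℝ, wInner p f g = g x - ∑ y, p y * g y := by
    intro g
    simp only [wInner, hfdef, sub_mul, mul_sub, Finset.sum_sub_distrib, ite_mul, zero_mul, mul_ite,
      mul_zero, Finset.sum_ite_eq', Finset.mem_univ, if_true, one_mul]
    have := (hP.weight_pos x).ne'
    field_simp
  have hpf : ∑ y, p y * f y = 0 := by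
    have := hfi fun _ => 1
    simpa [wInner, hP.weight_sum] using this
  -- at `x` itself the equation follows from the invariance of `p`
  have hPh : avg P h = fun y => h y + f y := by
    have hne : ∀ y, y ≠ x → avg P h y = h y + f y := fun y hy => by
      simp [hh y hy, hfdef, hy]; ring
    have hsum := hP.wInner_one_iterate 1 h
    simp only [Function.iterate_one] at hsum
    ext y
    by_cases hy : y = x
    · subst hy
      have h1 : ∑ z, p z * (avg P h z - (h z + f z)) = 0 := by
        simp only [mul_sub, mul_add, Finset.sum_sub_distrib, Finset.sum_add_distrib, hsum, hpf]
        ring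
      rw [Finset.sum_eq_single y (fun z _ hz => by rw [hne z hz]; ring) (by simp)] at h1
      rcases mul_eq_zero.1 h1 with h2 | h2
      · exact absurd h2 (hP.weight_pos y).ne'
      · linarith
    · exact hne y hy
  have hiter : ∀ m : ℕ, ∀ y, (avg P)^[m] h y = h y + ∑ u ∈ Finset.range m, (avg P)^[u] f y := by
    intro m
    induction m with
    | zero => simp
    | succ m ih =>
      intro y
      rw [Function.iterate_succ_apply', funext ih, avg_add, hPh, Finset.sum_range_succ',
        Function.iterate_zero_apply]
      have : avg P (fun z => ∑ u ∈ Finset.range m, (avg P)^[u] f z) y =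
          ∑ u ∈ Finset.range m, (avg P)^[u + 1] f y := by
        simp only [Function.iterate_succ_apply', avg, Finset.mul_sum]
        rw [Finset.sum_comm]
      rw [this]
      ring
  have hsumT : ∀ m : ℕ, ∑ u ∈ Finset.range m, wInner p f ((avg P)^[u] f) ≤ T := by
    intro m
    have h1 := hiter m x
    have h2 := hP.iterate_le hT m x
    have h3 := h0 x
    simp only [hfi, hP.wInner_one_iterate, hpf, sub_zero]
    linarith
  have hanti : Antitone fun k => wInner p ((avg P)^[k] f) ((avg P)^[k] f) :=
    antitone_nat_of_succ_le fun k => by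
      rw [Function.iterate_succ_apply']
      exact hP.wInner_avg_avg_le _
  have hpair : ∀ m : ℕ, ∑ k ∈ Finset.range m, wInner p ((avg P)^[k] f) ((avg P)^[k] f) ≤
      ∑ u ∈ Finset.range (2 * m), wInner p f ((avg P)^[u] f) := by
    intro m
    induction m with
    | zero => simp
    | succ m ih =>
      rw [Finset.sum_range_succ, Nat.mul_succ, Finset.sum_range_succ, Finset.sum_range_succ]
      have e1 : wInner p f ((avg P)^[2 * m] f) = wInner p ((avg P)^[m] f) ((avg P)^[m] f) := by
        rw [two_mul, Function.iterate_add_apply, hP.wInner_iterate]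
      have e2 : 0 ≤ wInner p f ((avg P)^[2 * m + 1] f) := by
        have : wInner p f ((avg P)^[2 * m + 1] f) =
            wInner p ((avg P)^[m] f) (avg P ((avg P)^[m] f)) := by
          rw [two_mul, add_assoc, Function.iterate_add_apply, hP.wInner_iterate,
            Function.iterate_succ_apply']
        rw [this]
        exact hP.psd _
      linarith
  have hnorm : n * wInner p ((avg P)^[n] f) ((avg P)^[n] f) ≤ T := by
    refine le_trans ?_ ((hpair n).trans (hsumT _))
    have := Finset.card_nsmul_le_sum (Finset.range n)
      (fun k => wInner p ((avg P)^[k] f) ((avg P)^[k] f)) _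
      fun k hk => hanti (Finset.mem_range.1 hk).le
    simpa using this
  have hn0' : (0 : ℝ) < n := by exact_mod_cast hn0
  have hsmall : wInner p ((avg P)^[n] f) ((avg P)^[n] f) ≤ 1 / 16 := by
    nlinarith
  have hφφ : wInner p φ φ ≤ 1 := by
    rw [← hP.weight_sum]
    refine Finset.sum_le_sum fun y _ => ?_
    exact mul_le_of_le_one_right (hP.weight_pos y).le (mul_le_one₀ (φ1 y) (φ0 y) (φ1 y))
  have hcs := hP.wInner_sq_le ((avg P)^[n] f) φ
  rw [← hP.wInner_iterate, hfi, hP.wInner_one_iterate] at hcs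
  have : ((avg P)^[n] φ x - ∑ y, p y * φ y) ^ 2 ≤ (1 / 4) ^ 2 := by
    have := mul_le_mul hsmall hφφ (hP.wInner_self_nonneg φ) (by norm_num)
    nlinarith
  have := abs_le_of_sq_le_sq' this (by norm_num)
  linarith [this.2]

/-- A moving target is avoided from the stationary start with exponentially small probability:
killing at the successive targets `b, b', …` multiplies the `ℓ²(p)`-norm by at most `1 - 1 / T` per
step, because `⟨f, P g⟩² ≤ ⟨f, P f⟩ ⟨g, P g⟩` and `P h ≤ (1 - 1 / T) h` off `b` for the mean
hitting time `h` of `b`. -/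
lemma stationary_avoid_le {T : ℝ} (hT1 : 1 ≤ T) (h : S → S → ℝ) (h0 : ∀ b y, 0 ≤ h b y)
    (hT : ∀ b y, h b y ≤ T) (hpos : ∀ b y, y ≠ b → 0 < h b y)
    (hh : ∀ b y, y ≠ b → avg P (h b) y = h b y - 1) (b : S) (bs : List S) :
    ∑ x, p x * hitMean P 0 ((b :: bs).map fun a => {a}) (fun _ => 1) x ≤
      (1 - 1 / T) ^ bs.length := by
  classical
  set c := 1 - 1 / T
  have hT0 : 0 < T := by linarith
  have hc : 0 ≤ c := by
    have : 1 / T ≤ 1 := by rw [div_le_one hT0]; exact hT1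
    linarith
  have hform : ∀ (a : S) (f : S → ℝ), f a = 0 → wInner p f (avg P f) ≤ c * wInner p f f := by
    intro a f hfa
    refine hP.wInner_avg_self_le (h0 a) fun x hx => ?_
    have hxa : x ≠ a := fun e => hx (e ▸ hfa)
    refine ⟨hpos a x hxa, ?_⟩
    rw [hh a x hxa]
    have h1 : h a x / T ≤ 1 := by rw [div_le_one hT0]; exact hT a x
    have : c * h a x = h a x - h a x / T := by simp only [c]; ring
    linarith
  -- `ψ b bs` is the probability of avoiding `bs`, killed at `b`
  set ψ : S → List S → S → ℝ := fun b bs y =>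
    (if y ∈ ({b} : Set S) then 0 else 1) * hitMean P 0 (bs.map fun a => {a}) (fun _ => 1) y with hψ
  have hψb : ∀ b bs, ψ b bs b = 0 := fun b bs => by simp [hψ]
  have hnorm : ∀ (bs : List S) (b : S), wInner p (ψ b bs) (ψ b bs) ≤ (c ^ bs.length) ^ 2 := by
    intro bs
    induction bs with
    | nil =>
      intro b
      rw [List.length_nil, pow_zero, one_pow, ← hP.weight_sum]
      refine Finset.sum_le_sum fun y _ => ?_
      refine mul_le_of_le_one_right (hP.weight_pos y).le ?_
      simp only [hψ, List.map_nil, hitMean, mul_one]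
      split_ifs <;> norm_num
    | cons b' bs ih =>
      intro b
      have e : wInner p (ψ b (b' :: bs)) (ψ b (b' :: bs)) =
          wInner p (ψ b (b' :: bs)) (avg P (ψ b' bs)) := by
        refine Finset.sum_congr rfl fun y _ => ?_
        have : ψ b (b' :: bs) y = (if y ∈ ({b} : Set S) then 0 else 1) * avg P (ψ b' bs) y := rfl
        rw [this]
        split_ifs <;> ring
      have h1 := hP.wInner_avg_sq_le (ψ b (b' :: bs)) (ψ b' bs)
      have h2 := mul_le_mul (hform b _ (hψb b (b' :: bs))) (hform b' _ (hψb b' bs)) (hP.psd _)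
        (mul_nonneg hc (hP.wInner_self_nonneg _))
      rw [← e] at h1
      have h3 := hP.wInner_self_nonneg (ψ b (b' :: bs))
      have h4 := ih b'
      have h5 : wInner p (ψ b (b' :: bs)) (ψ b (b' :: bs)) ≤
          c ^ 2 * wInner p (ψ b' bs) (ψ b' bs) := by
        rcases h3.eq_or_lt with h | h
        · rw [← h]
          exact mul_nonneg (sq_nonneg c) (hP.wInner_self_nonneg _)
        · nlinarith
      refine h5.trans ((mul_le_mul_of_nonneg_left h4 (sq_nonneg c)).trans_eq ?_)
      rw [List.length_cons]
      ring
  have e1 : ∑ x, p x * hitMean P 0 ((b :: bs).map fun a => {a}) (fun _ => 1) x =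
      wInner p (fun _ => 1) (ψ b bs) := by
    have := hP.wInner_one_iterate 1 (ψ b bs)
    simp only [wInner, one_mul]
    rw [← this]
    rfl
  rw [e1]
  have h1 := hP.wInner_sq_le (fun _ => 1) (ψ b bs)
  have h2 : wInner p (fun _ : S => (1 : ℝ)) (fun _ => 1) = 1 := by
    simp [wInner, hP.weight_sum]
  rw [h2, one_mul] at h1
  exact (abs_le_of_sq_le_sq' (h1.trans (hnorm bs b)) (pow_nonneg hc _)).2

/-- From any start, any moving target is hit within a window of order `T` with probability at
least `1 / 4`, if `T` bounds the mean hitting times `h b y` of `b` from `y`. -/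
lemma hitMean_window_le {T : ℝ} (hT1 : 1 ≤ T) (h : S → S → ℝ) (h0 : ∀ b y, 0 ≤ h b y)
    (hT : ∀ b y, h b y ≤ T) (hpos : ∀ b y, y ≠ b → 0 < h b y)
    (hh : ∀ b y, y ≠ b → avg P (h b) y = h b y - 1) {n s : ℕ} (hn : 16 * T ≤ n) (hs : T ≤ s)
    (bs : List S) (hbs : bs.length = n + (s + 1)) (x : S) :
    hitMean P 0 (bs.map fun a => {a}) (fun _ => 1) x ≤ 3 / 4 := by
  have hT0 : 0 < T := by linarith
  have hn0 : 0 < n := by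
    have : (0 : ℝ) < n := by linarith
    exact_mod_cast this
  rw [← List.take_append_drop n bs, List.map_append, hitMean_append]
  have hlen : (bs.drop n).length = s + 1 := by rw [List.length_drop, hbs]; omega
  obtain ⟨b, cs, hcs⟩ := List.exists_cons_of_length_eq_add_one hlen
  have hcsl : cs.length = s := by rw [hcs] at hlen; simpa using hlen
  set φ := hitMean P 0 ((bs.drop n).map fun a => {a}) fun _ => 1
  have φ0 : ∀ y, 0 ≤ φ y := fun y => hP.hitMean_nonneg le_rfl _ (fun _ => zero_le_one) y
  have φ1 : ∀ y, φ y ≤ 1 := fun y => hP.hitMean_one_le_one le_rfl zero_le_one _ y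
  have h1 := hP.hitMean_le_iterate le_rfl zero_le_one ((bs.take n).map fun a => ({a} : Set S)) φ0 x
  have hl : ((bs.take n).map fun a => ({a} : Set S)).length = n := by simp [hbs]
  rw [hl] at h1
  have h2 := hP.mixing (h0 x) (hT x) (hh x) φ0 φ1 hn hn0
  have h3 : ∑ y, p y * φ y ≤ (1 - 1 / T) ^ s := by
    have := hP.stationary_avoid_le hT1 h h0 hT hpos hh b cs
    rwa [← hcs, hcsl] at this
  have h4 : (1 - 1 / T) ^ s ≤ 1 / 2 := by
    have h5 : 1 - 1 / T ≤ Real.exp (-(1 / T)) := by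
      linarith [Real.add_one_le_exp (-(1 / T))]
    have h6 : 0 ≤ 1 - 1 / T := by
      have : 1 / T ≤ 1 := by rw [div_le_one hT0]; exact hT1
      linarith
    refine (pow_le_pow_left₀ h6 h5 s).trans ?_
    rw [← Real.exp_nat_mul]
    have h7 : (s : ℝ) * -(1 / T) ≤ -1 := by
      have : 1 ≤ (s : ℝ) / T := by rw [le_div_iff₀ hT0]; linarith
      have e : (s : ℝ) * -(1 / T) = -((s : ℝ) / T) := by ring
      linarith
    refine (Real.exp_le_exp.2 h7).trans ?_
    rw [Real.exp_neg, one_div]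
    have := Real.add_one_le_exp 1
    exact inv_anti₀ (by norm_num) (by linarith)
  linarith

end IsReversible

end Reversible

/-! ### The lazy walk on a connected graph -/

section LazyWalk

variable {V : Type*} [Fintype V] {G : SimpleGraph V}

/-- The degree of a vertex, as a real number. -/
noncomputable def degree {V : Type*} (G : SimpleGraph V) (a : V) : ℝ := ((G.neighborSet a).ncard : ℝ)

open Classical in
lemma degree_eq_sum (G : SimpleGraph V) (a : V) :
    degree G a = ∑ b, if G.Adj a b then (1 : ℝ) else 0 := by
  rw [Finset.sum_boole, degree, ← Set.ncard_coe_finset]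
  congr 2
  ext b
  simp

lemma degree_pos [Nontrivial V] (hG : G.Connected) (a : V) : 0 < degree G a := by
  obtain ⟨b, hb⟩ := hG.preconnected.exists_adj_of_nontrivial a
  have h : 0 < (G.neighborSet a).ncard := (Set.ncard_pos (Set.toFinite _)).2 ⟨b, hb⟩
  exact Nat.cast_pos.2 h

open Classical in
lemma lazyWalk_eq {V : Type*} (G : SimpleGraph V) (a b : V) : lazyWalk G a b =
    (if a = b then 1 / 2 else 0) + (if G.Adj a b then (1 : ℝ) else 0) / (2 * degree G a) := by
  by_cases h : a = b
  · subst h; simp [lazyWalk]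
  · simp [lazyWalk, h, degree, ite_div]

lemma lazyWalk_self {V : Type*} (G : SimpleGraph V) (a : V) : lazyWalk G a a = 1 / 2 := by simp [lazyWalk]

lemma lazyWalk_isStochastic [Nontrivial V] (hG : G.Connected) : IsStochastic (lazyWalk G) where
  nonneg a b := by
    classical
    rw [lazyWalk_eq]
    have := degree_pos hG a
    split_ifs <;> positivity
  sum_eq_one a := by
    classical
    simp only [lazyWalk_eq, Finset.sum_add_distrib, ← Finset.sum_div, ← degree_eq_sum]
    have := degree_pos hG a
    simp only [Finset.sum_ite_eq, Finset.mem_univ, if_true]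
    field_simp
    norm_num

/-- The stationary distribution is proportional to the degree; by laziness,
`⟨f, P f⟩` is a multiple of `∑_{a ~ b} (f a + f b)²`. -/
lemma lazyWalk_isReversible [Nontrivial V] (hG : G.Connected) :
    IsReversible (lazyWalk G) fun a => degree G a / ∑ b, degree G b := by
  classical
  have hD : 0 < ∑ b, degree G b :=
    Finset.sum_pos (fun b _ => degree_pos hG b) Finset.univ_nonempty
  have hsymm : ∀ a b, (if G.Adj a b then (1 : ℝ) else 0) = if G.Adj b a then (1 : ℝ) else 0 :=
    fun a b => by simp only [G.adj_comm a b]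
  refine { lazyWalk_isStochastic hG with
    weight_pos := fun a => div_pos (degree_pos hG a) hD
    weight_sum := by rw [← Finset.sum_div, div_self hD.ne']
    detailed_balance := fun a b => ?_
    psd := fun f => ?_ }
  · have ha := (degree_pos hG a).ne'
    have hb := (degree_pos hG b).ne'
    by_cases h : a = b
    · rw [h]
    · rw [lazyWalk_eq, lazyWalk_eq, if_neg h, if_neg (Ne.symm h), hsymm b a]
      field_simp
      simp
  · have h1 : ∀ a, degree G a / (∑ b, degree G b) * (f a * avg (lazyWalk G) f a) =
        (∑ b, (if G.Adj a b then (1 : ℝ) else 0) * (f a ^ 2 + f a * f b)) /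
          (2 * ∑ b, degree G b) := by
      intro a
      have ha := (degree_pos hG a).ne'
      have : avg (lazyWalk G) f a =
          f a / 2 + (∑ b, (if G.Adj a b then (1 : ℝ) else 0) * f b) / (2 * degree G a) := by
        simp only [avg, lazyWalk_eq, add_mul, Finset.sum_add_distrib, ite_mul, zero_mul,
          Finset.sum_ite_eq, Finset.mem_univ, if_true, Finset.sum_div]
        congr 1
        · ring
        · exact Finset.sum_congr rfl fun b _ => by split_ifs <;> ring
      rw [this]
      simp only [mul_add, Finset.sum_add_distrib, ← Finset.sum_mul, ← degree_eq_sum]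
      have e : ∑ b, (if G.Adj a b then (1 : ℝ) else 0) * (f a * f b) =
          f a * ∑ b, (if G.Adj a b then (1 : ℝ) else 0) * f b := by
        rw [Finset.mul_sum]
        exact Finset.sum_congr rfl fun b _ => by ring
      rw [e]
      field_simp
    simp only [wInner, h1, ← Finset.sum_div]
    refine div_nonneg ?_ (by positivity)
    have h2 : ∑ a, ∑ b, (if G.Adj a b then (1 : ℝ) else 0) * (f a ^ 2 + f a * f b) =
        ∑ a, ∑ b, (if G.Adj a b then (1 : ℝ) else 0) * (f b ^ 2 + f a * f b) := by
      rw [Finset.sum_comm]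
      refine Finset.sum_congr rfl fun a _ => Finset.sum_congr rfl fun b _ => ?_
      rw [hsymm b a]
      ring
    have h3 : 0 ≤ ∑ a, ∑ b, (if G.Adj a b then (1 : ℝ) else 0) * (f a + f b) ^ 2 :=
      Finset.sum_nonneg fun a _ => Finset.sum_nonneg fun b _ => by split_ifs <;> positivity
    have h4 : ∑ a, ∑ b, (if G.Adj a b then (1 : ℝ) else 0) * (f a + f b) ^ 2 =
        ∑ a, ∑ b, (if G.Adj a b then (1 : ℝ) else 0) * (f a ^ 2 + f a * f b) +
        ∑ a, ∑ b, (if G.Adj a b then (1 : ℝ) else 0) * (f b ^ 2 + f a * f b) := by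
      simp only [← Finset.sum_add_distrib]
      exact Finset.sum_congr rfl fun a _ => Finset.sum_congr rfl fun b _ => by ring
    linarith

lemma lazyWalk_pos_of_adj [Nontrivial V] (hG : G.Connected) {a b : V} (h : G.Adj a b) :
    0 < lazyWalk G a b := by
  classical
  rw [lazyWalk_eq, if_neg h.ne, if_pos h]
  have := degree_pos hG a
  positivity

/-- The transition matrix of two independent lazy walks. -/
noncomputable def pairWalk (G : SimpleGraph V) (x y : V × V) : ℝ :=
  lazyWalk G x.1 y.1 * lazyWalk G x.2 y.2

lemma pairWalk_isStochastic [Nontrivial V] (hG : G.Connected) : IsStochastic (pairWalk G) where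
  nonneg x y := mul_nonneg ((lazyWalk_isStochastic hG).nonneg _ _)
    ((lazyWalk_isStochastic hG).nonneg _ _)
  sum_eq_one x := by
    simp only [pairWalk, Fintype.sum_prod_type, ← Finset.mul_sum,
      (lazyWalk_isStochastic hG).sum_eq_one, mul_one]

lemma expectedHit_lazyWalk_lt_top [Nontrivial V] (hG : G.Connected) (a b : V) :
    expectedHit (lazyWalk G) a {b} < ∞ := by
  have hP := lazyWalk_isStochastic hG
  refine hP.expectedHit_lt_top {b} (fun x => ?_) a
  obtain ⟨w⟩ := hG.preconnected x b
  induction w with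
  | nil => exact ⟨0, by simp [avoid]⟩
  | cons h w ih =>
    obtain ⟨n, hn⟩ := ih
    exact ⟨n + 1, hP.avoid_lt_one_of_step _ (lazyWalk_pos_of_adj hG h) hn⟩

lemma expectedHit_pairWalk_lt_top [Nontrivial V] (hG : G.Connected) (x : V × V) :
    expectedHit (pairWalk G) x {x | x.1 = x.2} < ∞ := by
  have hP := pairWalk_isStochastic hG
  refine hP.expectedHit_lt_top _ (fun x => ?_) x
  obtain ⟨a, b⟩ := x
  obtain ⟨w⟩ := hG.preconnected a b
  induction w with
  | nil => exact ⟨0, by simp [avoid]⟩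
  | @cons u v w h _ ih =>
    obtain ⟨n, hn⟩ := ih
    refine ⟨n + 1, hP.avoid_lt_one_of_step _ ?_ hn⟩
    simp only [pairWalk, lazyWalk_self]
    have := lazyWalk_pos_of_adj hG h
    positivity

lemma hitTime_ne_top [Nontrivial V] (hG : G.Connected) : hitTime G ≠ ∞ := by
  refine ne_top_of_le_ne_top (b := ∑ a, ∑ b, expectedHit (lazyWalk G) a {b}) ?_ ?_
  · exact (ENNReal.sum_lt_top.2 fun a _ => ENNReal.sum_lt_top.2 fun b _ =>
      expectedHit_lazyWalk_lt_top hG a b).ne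
  · refine iSup_le fun a => iSup_le fun b => ?_
    exact (Finset.single_le_sum (f := fun b => expectedHit (lazyWalk G) a {b})
      (fun _ _ => zero_le) (Finset.mem_univ b)).trans
      (Finset.single_le_sum (f := fun a => ∑ b, expectedHit (lazyWalk G) a {b})
      (fun _ _ => zero_le) (Finset.mem_univ a))

lemma meetTime_ne_top [Nontrivial V] (hG : G.Connected) : meetTime G ≠ ∞ := by
  refine ne_top_of_le_ne_top (b := ∑ a, ∑ b, expectedHit (pairWalk G) (a, b) {x | x.1 = x.2}) ?_ ?_
  · exact (ENNReal.sum_lt_top.2 fun a _ => ENNReal.sum_lt_top.2 fun b _ =>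
      expectedHit_pairWalk_lt_top hG (a, b)).ne
  · refine iSup_le fun a => iSup_le fun b => ?_
    exact (Finset.single_le_sum (f := fun b => expectedHit (pairWalk G) (a, b) {x | x.1 = x.2})
      (fun _ _ => zero_le) (Finset.mem_univ b)).trans
      (Finset.single_le_sum (f := fun a => ∑ b, expectedHit (pairWalk G) (a, b) {x | x.1 = x.2})
      (fun _ _ => zero_le) (Finset.mem_univ a))

lemma one_le_hitTime [Nontrivial V] (hG : G.Connected) : 1 ≤ (hitTime G).toReal := by
  obtain ⟨a, b, hab⟩ := exists_pair_ne V
  rw [← ENNReal.toReal_one]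
  refine ENNReal.toReal_mono (hitTime_ne_top hG) ?_
  exact ((lazyWalk_isStochastic hG).one_le_expectedHit {b} (x := a) (by simpa using hab)).trans
    (le_iSup₂ (f := fun a b => expectedHit (lazyWalk G) a {b}) a b)

lemma one_le_meetTime [Nontrivial V] (hG : G.Connected) : 1 ≤ (meetTime G).toReal := by
  obtain ⟨a, b, hab⟩ := exists_pair_ne V
  rw [← ENNReal.toReal_one]
  refine ENNReal.toReal_mono (meetTime_ne_top hG) ?_
  exact ((pairWalk_isStochastic hG).one_le_expectedHit {x | x.1 = x.2} (x := (a, b))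
    (by simpa using hab)).trans
    (le_iSup₂ (f := fun a b => expectedHit (pairWalk G) (a, b) {x | x.1 = x.2}) a b)

/-- The length of a window in which a lazy walk hits any moving target with probability at least
`1 / 4`. -/
noncomputable def hitWindow (G : SimpleGraph V) : ℕ :=
  ⌈16 * (hitTime G).toReal⌉₊ + (⌈(hitTime G).toReal⌉₊ + 1)

/-- The length of a window in which two lazy walks meet with probability at least `1 / 2`. -/
noncomputable def meetWindow (G : SimpleGraph V) : ℕ := ⌈2 * (meetTime G).toReal⌉₊

lemma hitMean_hitWindow_le [Nontrivial V] (hG : G.Connected) (h : List (Set V))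
    (hh : ∀ A ∈ h, ∃ b, ({b} : Set V) = A) (hl : h.length = hitWindow G) (x : V) :
    hitMean (lazyWalk G) (1 / 2) h (fun _ => 1) x ≤ 7 / 8 := by
  have hP := lazyWalk_isReversible hG
  have hfin := expectedHit_lazyWalk_lt_top hG
  obtain ⟨bs, rfl⟩ : ∃ bs : List V, bs.map (fun b => ({b} : Set V)) = h := by
    clear hl
    induction h with
    | nil => exact ⟨[], rfl⟩
    | cons A h ih =>
      obtain ⟨bs, rfl⟩ := ih fun B hB => hh B (List.mem_cons_of_mem _ hB)
      obtain ⟨b, rfl⟩ := hh A List.mem_cons_self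
      exact ⟨b :: bs, rfl⟩
  have key := hP.hitMean_window_le (one_le_hitTime hG)
    (fun b y => (expectedHit (lazyWalk G) y {b}).toReal) (fun _ _ => ENNReal.toReal_nonneg)
    (fun b y => ENNReal.toReal_mono (hitTime_ne_top hG)
      (le_iSup₂ (f := fun a b => expectedHit (lazyWalk G) a {b}) y b))
    (fun b y hy => ENNReal.toReal_pos
      (zero_lt_one.trans_le (hP.one_le_expectedHit {b} (x := y) (by simpa using hy))).ne'
      (hfin y b).ne)
    (fun b y hy => by
      rw [hP.toReal_expectedHit {b} (fun x => hfin x b) (x := y) (by simpa using hy)]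
      ring)
    (Nat.le_ceil _) (Nat.le_ceil _) bs (by simpa [hitWindow] using hl) x
  refine (hP.hitMean_le_avoid (by norm_num) (by norm_num) _ x).trans ?_
  linarith

lemma hitMean_meetWindow_le [Nontrivial V] (hG : G.Connected) (h : List (Set (V × V)))
    (hh : ∀ A ∈ h, A = {x | x.1 = x.2}) (hl : h.length = meetWindow G) (x : V × V) :
    hitMean (pairWalk G) (1 / 2) h (fun _ => 1) x ≤ 7 / 8 := by
  have hP := pairWalk_isStochastic hG
  have hT := one_le_meetTime hG
  have hW : 2 * (meetTime G).toReal ≤ meetWindow G := Nat.le_ceil _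
  obtain ⟨n, hn⟩ : ∃ n, meetWindow G = n + 1 :=
    Nat.exists_eq_succ_of_ne_zero (by rintro h; rw [h] at hW; norm_num at hW; linarith)
  rw [List.eq_replicate_of_mem hh, hl, hn]
  refine (hP.hitMean_le_avoid (by norm_num) (by norm_num) _ x).trans ?_
  rw [hitMean_zero_replicate]
  have : avg (pairWalk G) (avoid (pairWalk G) {x | x.1 = x.2} n) x ≤ 1 / 2 := by
    refine hP.avg_le (fun y => ?_) x
    refine (hP.avoid_le_div {x | x.1 = x.2} (T := (meetTime G).toReal) (by linarith) ?_ n).trans ?_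
    · rw [ENNReal.ofReal_toReal (meetTime_ne_top hG)]
      exact le_iSup₂ (f := fun a b => expectedHit (pairWalk G) (a, b) {x | x.1 = x.2}) y.1 y.2
    · rw [hn] at hW
      push_cast at hW
      rw [div_le_iff₀ (by linarith)]
      linarith
  linarith

end LazyWalk

/-! ### Several independent walks and their meetings -/

section PathMean

variable {S : Type*} [Fintype S]

/-- The mean of `Φ [X_1, …, X_t]` for the chain `X` started at the given state. -/
def pathMean (P : S → S → ℝ) : ℕ → (List S → ℝ) → S → ℝ
  | 0, Φ, _ => Φ []
  | t + 1, Φ, a => avg P (fun b => pathMean P t (fun h => Φ (b :: h)) b) a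

lemma IsStochastic.pathMean_le {P : S → S → ℝ} (hP : IsStochastic P) {c : ℝ} (t : ℕ)
    (Φ : List S → ℝ) (hΦ : ∀ h, h.length = t → Φ h ≤ c) (a : S) : pathMean P t Φ a ≤ c := by
  induction t generalizing Φ a with
  | zero => exact hΦ [] rfl
  | succ t ih => exact hP.avg_le (fun b => ih _ (fun h hh => hΦ _ (by simp [hh])) b) a

lemma pathMean_sum (P : S → S → ℝ) {ι : Type*} (s : Finset ι) (c : ι → ℝ)
    (Φ : ι → List S → ℝ) (t : ℕ) (a : S) :
    pathMean P t (fun h => ∑ k ∈ s, c k * Φ k h) a = ∑ k ∈ s, c k * pathMean P t (Φ k) a := by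
  induction t generalizing Φ a with
  | zero => rfl
  | succ t ih =>
    simp only [pathMean, ih, avg, Finset.mul_sum]
    rw [Finset.sum_comm]
    exact Finset.sum_congr rfl fun k _ => Finset.sum_congr rfl fun b _ => by ring

/-- The mean of `g (X_1) * ⋯ * g (X_t)` for the chain `X` started at the given state. -/
def weightMean (P : S → S → ℝ) (g : S → ℝ) : ℕ → S → ℝ
  | 0, _ => 1
  | t + 1, v => avg P (fun w => g w * weightMean P g t w) v

end PathMean

section Product

variable {V ι : Type*} [Fintype V] [Fintype ι] [DecidableEq ι]

/-- The transition matrix of a family of independent copies of a chain. -/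
def prodWalk (P : V → V → ℝ) (v w : ι → V) : ℝ := ∏ k, P (v k) (w k)

open Classical in
/-- The weight `θ ^ #{j ∈ s | j is at the same site as i}` of a configuration. -/
noncomputable def meetWeight (θ : ℝ) (i : ι) (s : Finset ι) (w : ι → V) : ℝ :=
  ∏ j ∈ s, if w j = w i then θ else 1

open Classical in
/-- Given the step of `i`, the steps of the others are independent. -/
lemma sum_prodWalk {P : V → V → ℝ} (hP : IsStochastic P) {i : ι} {s : Finset ι} (hi : i ∉ s)
    (v : ι → V) (b : V) (c : ι → V → ℝ) :
    ∑ w : ι → V, (if w i = b then prodWalk P v w * ∏ j ∈ s, c j (w j) else 0) =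
      P (v i) b * ∏ j ∈ s, avg P (c j) (v j) := by
  -- the summand is a product over the coordinates
  set F : ι → V → ℝ := fun k y =>
    P (v k) y * (if k = i then (if y = b then 1 else 0) else 1) * (if k ∈ s then c k y else 1)
    with hF
  have h1 : ∀ w : ι → V, (if w i = b then prodWalk P v w * ∏ j ∈ s, c j (w j) else 0) =
      ∏ k, F k (w k) := by
    intro w
    simp only [hF, Finset.prod_mul_distrib, Finset.prod_ite_eq', Finset.mem_univ, if_true,
      Finset.prod_ite_mem, Finset.univ_inter, prodWalk]
    split_ifs <;> simp
  have h2 := Finset.prod_univ_sum (fun _ : ι => (Finset.univ : Finset V)) F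
  rw [Fintype.piFinset_univ] at h2
  rw [Finset.sum_congr rfl fun w _ => h1 w, ← h2]
  have h3 : ∀ k, ∑ y, F k y =
      (if k = i then P (v i) b else 1) * (if k ∈ s then avg P (c k) (v k) else 1) := by
    intro k
    by_cases hk : k = i
    · subst hk
      simp [hF, hi]
    · by_cases hs : k ∈ s
      · simp [hF, hk, hs, avg]
      · simp [hF, hk, hs, hP.sum_eq_one]
  rw [Finset.prod_congr rfl fun k _ => h3 k]
  simp only [Finset.prod_mul_distrib, Finset.prod_ite_eq', Finset.mem_univ, if_true,
    Finset.prod_ite_mem, Finset.univ_inter]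

/-- Averaging over the path of `i`, the other walks are independent chains with a moving
target. -/
lemma weightMean_eq_pathMean {P : V → V → ℝ} (hP : IsStochastic P) (θ : ℝ) {i : ι} {s : Finset ι}
    (hi : i ∉ s) (t : ℕ) (v : ι → V) :
    weightMean (prodWalk P) (meetWeight θ i s) t v =
      pathMean P t (fun h => ∏ j ∈ s, hitMean P θ (h.map fun b => {b}) (fun _ => 1) (v j))
        (v i) := by
  classical
  induction t generalizing v with
  | zero => simp [weightMean, pathMean, hitMean]
  | succ t ih =>
    simp only [weightMean, ih, pathMean]
    set H : V → List V → V → ℝ := fun b h y =>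
      (if y ∈ ({b} : Set V) then θ else 1) * hitMean P θ (h.map fun b => {b}) (fun _ => 1) y with hH
    have hr : ∀ b, P (v i) b * pathMean P t (fun h => ∏ j ∈ s, hitMean P θ
        ((b :: h).map fun b => {b}) (fun _ => 1) (v j)) b =
        ∑ w : ι → V, (if w i = b then prodWalk P v w else 0) *
          pathMean P t (fun h => ∏ j ∈ s, H b h (w j)) b := by
      intro b
      rw [← pathMean_sum]
      have := pathMean_sum P {()} (fun _ => P (v i) b) (fun _ h => ∏ j ∈ s, hitMean P θ
        ((b :: h).map fun b => {b}) (fun _ => 1) (v j)) t b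
      simp only [Finset.sum_singleton] at this
      rw [← this]
      congr 1
      ext h
      have e := sum_prodWalk hP hi v b fun _ => H b h
      simp only [ite_mul, zero_mul]
      rw [e]
      rfl
    simp only [avg, hr]
    rw [Finset.sum_comm]
    refine Finset.sum_congr rfl fun w _ => ?_
    rw [Finset.sum_eq_single (w i)]
    · rw [if_pos rfl]
      congr 1
      have := pathMean_sum P {()} (fun _ => meetWeight θ i s w)
        (fun _ h => ∏ j ∈ s, hitMean P θ (h.map fun b => {b}) (fun _ => 1) (w j)) t (w i)
      simp only [Finset.sum_singleton] at this
      rw [← this]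
      congr 1
      ext h
      rw [meetWeight, ← Finset.prod_mul_distrib]
      refine Finset.prod_congr rfl fun j _ => ?_
      simp only [hH, Set.mem_singleton_iff]
    · intro b _ hb
      rw [if_neg fun h => hb h.symm, zero_mul]
    · simp

/-- For two walks the weights count the visits of the pair to the diagonal. -/
lemma weightMean_singleton {G : SimpleGraph V} [Nontrivial V] (hG : G.Connected) (θ : ℝ)
    {i j : ι} (hij : i ≠ j) (t : ℕ) (v : ι → V) :
    weightMean (prodWalk (lazyWalk G)) (meetWeight θ i {j}) t v =
      hitMean (pairWalk G) θ (List.replicate t {x | x.1 = x.2}) (fun _ => 1) (v i, v j) := by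
  classical
  have hP := lazyWalk_isStochastic hG
  induction t generalizing v with
  | zero => simp [weightMean, hitMean]
  | succ t ih =>
    simp only [weightMean, ih, List.replicate_succ, hitMean]
    set f : V × V → ℝ := fun y => (if y ∈ {x : V × V | x.1 = x.2} then θ else 1) *
      hitMean (pairWalk G) θ (List.replicate t {x | x.1 = x.2}) (fun _ => 1) y with hf
    have h1 : ∀ b, ∑ y, pairWalk G (v i, v j) (b, y) * f (b, y) =
        ∑ w : ι → V, (if w i = b then prodWalk (lazyWalk G) v w * f (b, w j) else 0) := by
      intro b
      have e := sum_prodWalk hP (i := i) (s := {j}) (by simpa using hij) v b fun _ y => f (b, y)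
      simp only [Finset.prod_singleton] at e
      rw [e, avg, Finset.mul_sum]
      exact Finset.sum_congr rfl fun y _ => by simp only [pairWalk]; ring
    simp only [avg, Fintype.sum_prod_type]
    refine Eq.trans ?_ (Finset.sum_congr rfl fun b _ => (h1 b).symm)
    rw [Finset.sum_comm]
    refine Finset.sum_congr rfl fun w _ => ?_
    rw [Finset.sum_ite_eq]
    simp only [Finset.mem_univ, if_true, hf, meetWeight, Finset.prod_singleton,
      Set.mem_ofPred_eq, eq_comm]

end Product

/-! ### The walks of the legitimate robots -/

section Robots

variable {Ω R V : Type*} {L : Finset R} {χ : ℕ → R → Ω → V} {α : ℕ → R → R → Ω → ℝ}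

lemma record_mono {s s' t t' : ℕ} (hs : s ≤ s') (ht : t ≤ t') :
    record L χ α s t ≤ record L χ α s' t' :=
  sup_le_sup (biSup_mono fun _ h => le_trans h hs) (biSup_mono fun _ h => lt_of_lt_of_le h ht)

lemma measurableSet_record_site {r s t : ℕ} (hr : r ≤ s) (i : R) (v : V) :
    MeasurableSet[record L χ α s t] {ω | χ r i ω = v} := by
  have h : MeasurableSpace.comap (χ r i) ⊤ ≤ record L χ α s t :=
    le_trans (le_trans (le_iSup (fun i => MeasurableSpace.comap (χ r i) ⊤) i)
      (le_iSup₂ (f := fun r (_ : r ∈ Set.Iic s) =>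
        ⨆ i : R, MeasurableSpace.comap (χ r i) ⊤) r hr)) le_sup_left
  exact h _ ⟨{v}, trivial, rfl⟩

lemma measurable_record_obs {r s t : ℕ} (hr : r < t) (p : ObsPair L) :
    Measurable[record L χ α s t] (α r p.1.1 p.1.2) := by
  have h : MeasurableSpace.comap (α r p.1.1 p.1.2) (inferInstance : MeasurableSpace ℝ) ≤
      record L χ α s t :=
    le_trans (le_trans (le_iSup (fun p : ObsPair L =>
        MeasurableSpace.comap (α r p.1.1 p.1.2) (inferInstance : MeasurableSpace ℝ)) p)
      (le_iSup₂ (f := fun r (_ : r ∈ Set.Iio t) => ⨆ p : ObsPair L,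
        MeasurableSpace.comap (α r p.1.1 p.1.2) (inferInstance : MeasurableSpace ℝ)) r hr))
      le_sup_right
  exact measurable_iff_comap_le.2 h

/-- The sites of the legitimate robots at time `t`. -/
def config (L : Finset R) (χ : ℕ → R → Ω → V) (t : ℕ) (ω : Ω) : L → V := fun i => χ t i ω

lemma config_eq_iff [Nonempty L] (t : ℕ) (v : L → V) :
    ∃ v' : R → V, (∀ i : L, v' i = v i) ∧
      {ω | config L χ t ω = v} = {ω | ∀ i ∈ L, χ t i ω = v' i} := by
  classical
  refine ⟨fun i => if h : i ∈ L then v ⟨i, h⟩ else v (Classical.arbitrary L), fun i => by simp, ?_⟩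
  ext ω
  simp only [config, Set.mem_ofPred_eq, funext_iff, Subtype.forall]
  refine forall₂_congr fun i hi => ?_
  rw [dif_pos hi]

lemma measurableSet_record_config {r s t : ℕ} (hr : r ≤ s) (v : L → V) :
    MeasurableSet[record L χ α s t] {ω | config L χ r ω = v} := by
  have : {ω | config L χ r ω = v} = ⋂ i : L, {ω | χ r i ω = v i} := by
    ext ω; simp [config, funext_iff]
  rw [this]
  exact @MeasurableSet.iInter _ _ (record L χ α s t) _ _ fun i =>
    measurableSet_record_site (L := L) (χ := χ) (α := α) (s := s) (t := t) hr (i : R) (v i)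

open Classical in
/-- The number of times in `s + 1, …, s + t` at which `i` and `j` are at the same site. -/
noncomputable def meetCount (χ : ℕ → R → Ω → V) (s t : ℕ) (i j : R) (ω : Ω) : ℕ :=
  ((Finset.range t).filter fun r => χ (s + 1 + r) j ω = χ (s + 1 + r) i ω).card

lemma prod_meetWeight (s t : ℕ) (i : L) (J : Finset L) (ω : Ω) :
    ∏ r ∈ Finset.range t, meetWeight (1 / 2) i J (config L χ (s + 1 + r) ω) =
      ∏ j ∈ J, (1 / 2 : ℝ) ^ meetCount χ s t i j ω := by
  classical
  simp only [meetWeight]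
  rw [Finset.prod_comm]
  refine Finset.prod_congr rfl fun j _ => ?_
  rw [meetCount, Finset.prod_ite, Finset.prod_const, Finset.prod_const_one, mul_one]
  rfl

variable [mΩ : MeasurableSpace Ω] {μ : Measure Ω} {G : SimpleGraph V} {ε : ℝ}

namespace IsTeamProcess

variable (hX : IsTeamProcess μ G L ε χ α)
include hX

lemma record_le (s t : ℕ) : record L χ α s t ≤ mΩ :=
  sup_le (iSup₂_le fun r _ => iSup_le fun i => measurable_iff_comap_le.1 (hX.measurable_site r i))
    (iSup₂_le fun r _ => iSup_le fun _ => measurable_iff_comap_le.1 (hX.measurable_obs r _ _))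

lemma measurableSet_config (t : ℕ) (v : L → V) : MeasurableSet {ω | config L χ t ω = v} :=
  hX.record_le t 0 _ (measurableSet_record_config le_rfl v)

lemma setIntegral_config (t : ℕ) {A : Set Ω} (hA : MeasurableSet A) (φ : (L → V) → ℝ) (v : L → V) :
    ∫ ω in A ∩ {ω | config L χ t ω = v}, φ (config L χ t ω) ∂μ =
      φ v * μ.real (A ∩ {ω | config L χ t ω = v}) := by
  rw [setIntegral_congr_fun (g := fun _ => φ v) (hA.inter (hX.measurableSet_config t v))
    fun ω hω => by simp only [hω.2.symm]]
  simp [mul_comm]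

variable [Fintype V] [DecidableEq R]

lemma measurable_config (t : ℕ) (g : (L → V) → ℝ) : Measurable fun ω => g (config L χ t ω) := by
  classical
  have : (fun ω => g (config L χ t ω)) = fun ω =>
      ∑ v, {ω | config L χ t ω = v}.indicator (fun _ => g v) ω := by
    ext ω
    simp only [Set.indicator_apply, Set.mem_ofPred_eq]
    rw [Finset.sum_ite_eq]
    simp
  rw [this]
  exact Finset.measurable_sum _ fun v _ => measurable_const.indicator (hX.measurableSet_config t v)

lemma setIntegral_eq_sum_config (t : ℕ) {A : Set Ω} (hA : MeasurableSet A) {f : Ω → ℝ}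
    (hf : Integrable f μ) :
    ∫ ω in A, f ω ∂μ = ∑ v, ∫ ω in A ∩ {ω | config L χ t ω = v}, f ω ∂μ := by
  rw [← integral_iUnion_fintype (fun v => hA.inter (hX.measurableSet_config t v)) ?_
    fun v => hf.integrableOn]
  · congr 2
    ext ω
    simp
  · intro v w hvw
    exact Set.disjoint_left.2 fun ω h1 h2 => hvw (h1.2.symm.trans h2.2)

variable [IsProbabilityMeasure μ]

lemma integrable_config (t : ℕ) (φ : (L → V) → ℝ) :
    Integrable (fun ω => φ (config L χ t ω)) μ := by
  refine Integrable.of_bound (hX.measurable_config t φ).aestronglyMeasurable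
    (∑ v, ‖φ v‖) (.of_forall fun ω => ?_)
  exact Finset.single_le_sum (f := fun v => ‖φ v‖) (fun v _ => norm_nonneg _) (Finset.mem_univ _)

/-- The Markov property of the legitimate robots. -/
lemma measure_config_succ [Nonempty L] (t : ℕ) {A : Set Ω}
    (hA : MeasurableSet[record L χ α t (t + 1)] A) (w : L → V) :
    μ.real (A ∩ {ω | config L χ (t + 1) ω = w}) =
      ∫ ω in A, prodWalk (lazyWalk G) (config L χ t ω) w ∂μ := by
  have hA' := hX.record_le _ _ _ hA
  rw [hX.setIntegral_eq_sum_config t hA'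
    (hX.integrable_config t fun v => prodWalk (lazyWalk G) v w)]
  have h1 : μ.real (A ∩ {ω | config L χ (t + 1) ω = w}) =
      ∫ ω in A, {ω | config L χ (t + 1) ω = w}.indicator (fun _ => (1 : ℝ)) ω ∂μ := by
    rw [setIntegral_indicator (hX.measurableSet_config _ w)]
    simp
  rw [h1, hX.setIntegral_eq_sum_config t hA'
    ((integrable_const 1).indicator (hX.measurableSet_config _ w))]
  refine Finset.sum_congr rfl fun v _ => ?_
  rw [hX.setIntegral_config t hA' (fun v => prodWalk (lazyWalk G) v w) v,
    setIntegral_indicator (hX.measurableSet_config _ w)]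
  obtain ⟨v', hv', hv⟩ := config_eq_iff (χ := χ) t v
  obtain ⟨w', hw', hw⟩ := config_eq_iff (χ := χ) (t + 1) w
  have := hX.walk t A hA v' w'
  rw [← hv, ← hw, ← Finset.prod_coe_sort] at this
  simp only [hv', hw'] at this
  simp only [setIntegral_const, smul_eq_mul, mul_one]
  rw [this, mul_comm]
  rfl

/-- From any time `s` on, the weighted mean of the process is that of the product chain. -/
lemma setIntegral_prod_config [Nonempty L] (g : (L → V) → ℝ) (t s : ℕ) {A : Set Ω}
    (hA : MeasurableSet[record L χ α s (s + 1)] A) :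
    ∫ ω in A, ∏ r ∈ Finset.range t, g (config L χ (s + 1 + r) ω) ∂μ =
      ∫ ω in A, weightMean (prodWalk (lazyWalk G)) g t (config L χ s ω) ∂μ := by
  induction t generalizing s A with
  | zero => simp [weightMean]
  | succ t ih =>
    have hA' := hX.record_le _ _ _ hA
    have hA1 : ∀ w : L → V, MeasurableSet[record L χ α (s + 1) (s + 1 + 1)]
        (A ∩ {ω | config L χ (s + 1) ω = w}) := fun w =>
      MeasurableSet.inter (record_mono (Nat.le_succ s) (Nat.le_succ _) _ hA)
        (measurableSet_record_config le_rfl w)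
    have hint : ∀ t s : ℕ, Integrable
        (fun ω => ∏ r ∈ Finset.range t, g (config L χ (s + 1 + r) ω)) μ := by
      intro t s
      refine Integrable.of_bound (Finset.measurable_prod _ fun r _ =>
        hX.measurable_config _ g).aestronglyMeasurable ((∑ v, ‖g v‖) ^ t) (.of_forall fun ω => ?_)
      rw [norm_prod]
      refine (Finset.prod_le_prod (fun r _ => norm_nonneg _)
        (g := fun _ => ∑ v, ‖g v‖) fun r _ => ?_).trans_eq (by simp)
      exact Finset.single_le_sum (f := fun v => ‖g v‖) (fun v _ => norm_nonneg _)
        (Finset.mem_univ _)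
    have step : ∀ w : L → V, ∫ ω in A ∩ {ω | config L χ (s + 1) ω = w},
        ∏ r ∈ Finset.range (t + 1), g (config L χ (s + 1 + r) ω) ∂μ =
        ∫ ω in A, prodWalk (lazyWalk G) (config L χ s ω) w *
          (g w * weightMean (prodWalk (lazyWalk G)) g t w) ∂μ := by
      intro w
      have e1 : ∫ ω in A ∩ {ω | config L χ (s + 1) ω = w},
          ∏ r ∈ Finset.range (t + 1), g (config L χ (s + 1 + r) ω) ∂μ =
          ∫ ω in A ∩ {ω | config L χ (s + 1) ω = w},
          (∏ r ∈ Finset.range t, g (config L χ (s + 1 + 1 + r) ω)) * g w ∂μ := by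
        refine setIntegral_congr_fun (hA'.inter (hX.measurableSet_config _ w)) fun ω hω => ?_
        simp only [Finset.prod_range_succ', add_zero]
        rw [show config L χ (s + 1) ω = w from hω.2]
        congr 1
        exact Finset.prod_congr rfl fun r _ => by rw [add_assoc (s + 1) 1 r, add_comm 1 r]
      rw [e1, integral_mul_const, ih (s + 1) (hA1 w), hX.setIntegral_config _ hA',
        hX.measure_config_succ s hA, integral_mul_const]
      ring
    rw [hX.setIntegral_eq_sum_config (s + 1) hA' (hint (t + 1) s),
      Finset.sum_congr rfl fun w _ => step w, ← integral_finsetSum]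
    · rfl
    · exact fun w _ => (hX.integrable_config s fun v => prodWalk (lazyWalk G) v w *
        (g w * weightMean (prodWalk (lazyWalk G)) g t w)).integrableOn

end IsTeamProcess

namespace IsTeamProcess

variable [DecidableEq R] [Fintype V] [IsProbabilityMeasure μ] (hX : IsTeamProcess μ G L ε χ α)
include hX

/-- Markov's inequality for the product of the weights `(1 / 2) ^ meetCount`. -/
lemma measure_meetCount_lt_le (s t : ℕ) (i : L) (J : Finset L) (n : ℝ) {c : ℝ}
    (hc : ∀ v, weightMean (prodWalk (lazyWalk G)) (meetWeight (1 / 2) i J) t v ≤ c) :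
    μ.real {ω | ∀ j ∈ J, (meetCount χ s t i j ω : ℝ) < n} ≤ (2 ^ n) ^ J.card * c := by
  have : Nonempty L := ⟨i⟩
  set f : Ω → ℝ := fun ω =>
    ∏ r ∈ Finset.range t, meetWeight (1 / 2) i J (config L χ (s + 1 + r) ω) with hfdef
  have hf : ∀ ω, f ω = ∏ j ∈ J, (1 / 2 : ℝ) ^ meetCount χ s t i j ω := fun ω =>
    prod_meetWeight s t i J ω
  have hf0 : ∀ ω, 0 ≤ f ω := fun ω => by
    rw [hf]; exact Finset.prod_nonneg fun j _ => by positivity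
  have hf1 : ∀ ω, f ω ≤ 1 := fun ω => by
    rw [hf]
    exact Finset.prod_le_one (fun j _ => by positivity)
      fun j _ => pow_le_one₀ (by norm_num) (by norm_num)
  have hfm : Measurable f := Finset.measurable_prod _ fun r _ => hX.measurable_config _ _
  have hfi : Integrable f μ := Integrable.of_bound hfm.aestronglyMeasurable 1
    (.of_forall fun ω => by rw [Real.norm_of_nonneg (hf0 ω)]; exact hf1 ω)
  have h1 := hX.setIntegral_prod_config (meetWeight (1 / 2) i J) t s
    (A := Set.univ) MeasurableSet.univ
  simp only [setIntegral_univ] at h1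
  have h2 : ∫ ω, f ω ∂μ ≤ c := by
    rw [hfdef, h1]
    refine (integral_mono (hX.integrable_config s _) (integrable_const c) fun ω => hc _).trans_eq ?_
    simp
  have h3 := mul_meas_ge_le_integral_of_nonneg (.of_forall hf0) hfi (((2 : ℝ) ^ n)⁻¹ ^ J.card)
  have h4 : μ.real {ω | ∀ j ∈ J, (meetCount χ s t i j ω : ℝ) < n} ≤
      μ.real {ω | ((2 : ℝ) ^ n)⁻¹ ^ J.card ≤ f ω} := by
    refine measureReal_mono fun ω hω => ?_
    simp only [Set.mem_ofPred_eq, hf]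
    rw [← Finset.prod_const]
    refine Finset.prod_le_prod (fun j _ => by positivity) fun j hj => ?_
    rw [one_div, inv_pow, ← Real.rpow_natCast]
    exact inv_anti₀ (by positivity) (Real.rpow_le_rpow_of_exponent_le (by norm_num) (hω j hj).le)
  have hpos : (0 : ℝ) < ((2 : ℝ) ^ n)⁻¹ ^ J.card := by positivity
  have h5 := (mul_le_mul_of_nonneg_left h4 hpos.le).trans (h3.trans h2)
  rw [inv_pow, inv_mul_le_iff₀ (by positivity)] at h5
  exact h5

variable [Nontrivial V]

/-- Given the path of `i`, the robots of `J` are independent walks with a moving target. -/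
lemma measure_few_meetings_hit (hG : G.Connected) (s w : ℕ) (i : L) {J : Finset L}
    (hi : i ∉ J) (n : ℝ) :
    μ.real {ω | ∀ j ∈ J, (meetCount χ s (hitWindow G * w) i j ω : ℝ) < n} ≤
      (2 ^ n * (7 / 8) ^ w) ^ J.card := by
  have hP := lazyWalk_isStochastic hG
  rw [mul_pow]
  refine hX.measure_meetCount_lt_le s _ i J n fun v => ?_
  rw [weightMean_eq_pathMean hP (1 / 2) hi]
  refine hP.pathMean_le _ _ (fun h hh => ?_) _
  rw [← Finset.prod_const]
  refine Finset.prod_le_prod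
    (fun j _ => hP.hitMean_nonneg (by norm_num) _ (fun _ => zero_le_one) _) fun j _ => ?_
  refine hP.hitMean_le_pow (by norm_num) (by norm_num) (fun A => ∃ b, ({b} : Set V) = A)
    (hitWindow G) (hitMean_hitWindow_le hG) w _ (fun A hA => ?_) (by simpa using hh) _
  obtain ⟨b, -, rfl⟩ := List.mem_map.1 hA
  exact ⟨b, rfl⟩

lemma measure_few_meetings_meet (hG : G.Connected) (s w : ℕ) {i j : L}
    (hij : i ≠ j) (n : ℝ) :
    μ.real {ω | (meetCount χ s (meetWindow G * w) i j ω : ℝ) < n} ≤ 2 ^ n * (7 / 8) ^ w := by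
  have hP := pairWalk_isStochastic hG
  have := hX.measure_meetCount_lt_le s (meetWindow G * w) i {j} n (c := (7 / 8) ^ w) fun v => by
    rw [weightMean_singleton hG _ hij]
    exact hP.hitMean_le_pow (by norm_num) (by norm_num) (fun A => A = {x | x.1 = x.2})
      (meetWindow G) (hitMean_meetWindow_le hG) w _ (fun A hA => List.eq_of_mem_replicate hA)
      (by simp) _
  simpa using this

end IsTeamProcess

end Robots

/-! ### Concentration of the trust observations -/

section Observations

variable {Ω : Type*} [mΩ : MeasurableSpace Ω] {μ : Measure Ω}

/-- Hoeffding's lemma for an observation whose mean is at least `ε` on the correct side of `1 / 2`;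
the correct side is given by the sign `σ`. -/
lemma lintegral_exp_obs_le_one [IsProbabilityMeasure μ] {Y : Ω → ℝ} (hY : Measurable Y)
    (h01 : ∀ᵐ ω ∂μ, Y ω ∈ Set.Icc (0 : ℝ) 1) {ε σ : ℝ} (hε : 0 ≤ ε) (hσ : σ ^ 2 = 1)
    (hmean : ε ≤ σ * (∫ ω, Y ω ∂μ - 1 / 2)) :
    ∫⁻ ω, ENNReal.ofReal (Real.exp (2 * ε ^ 2 - 4 * ε * (σ * (Y ω - 1 / 2)))) ∂μ ≤ 1 := by
  have hsub := hasSubgaussianMGF_of_mem_Icc hY.aemeasurable h01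
  set m := ∫ ω, Y ω ∂μ
  have hmgf := hsub.mgf_le (-(4 * ε * σ))
  have hint := hsub.integrable_exp_mul (-(4 * ε * σ))
  have e : (((‖(1 : ℝ) - 0‖₊ / 2) ^ 2 : NNReal) : ℝ) * (-(4 * ε * σ)) ^ 2 / 2 = 2 * ε ^ 2 := by
    simp only [sub_zero, nnnorm_one, NNReal.coe_pow, NNReal.coe_div, NNReal.coe_one, NNReal.coe_ofNat]
    linear_combination 2 * ε ^ 2 * hσ
  rw [e, mgf] at hmgf
  calc ∫⁻ ω, ENNReal.ofReal (Real.exp (2 * ε ^ 2 - 4 * ε * (σ * (Y ω - 1 / 2)))) ∂μ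
      ≤ ∫⁻ ω, ENNReal.ofReal (Real.exp (-(2 * ε ^ 2)) *
          Real.exp (-(4 * ε * σ) * (Y ω - m))) ∂μ := by
        refine lintegral_mono fun ω => ENNReal.ofReal_le_ofReal ?_
        rw [← Real.exp_add, Real.exp_le_exp]
        nlinarith [mul_le_mul_of_nonneg_left hmean hε]
    _ = ENNReal.ofReal (∫ ω, Real.exp (-(2 * ε ^ 2)) * Real.exp (-(4 * ε * σ) * (Y ω - m)) ∂μ) := by
        rw [ofReal_integral_eq_lintegral_ofReal (hint.const_mul _)
          (.of_forall fun ω => by positivity)]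
    _ ≤ 1 := by
        rw [ENNReal.ofReal_le_one, integral_const_mul]
        refine (mul_le_mul_of_nonneg_left hmgf (Real.exp_pos _).le).trans_eq ?_
        rw [← Real.exp_add, neg_add_cancel, Real.exp_zero]

variable {R V : Type*} {L : Finset R} {χ : ℕ → R → Ω → V} {α : ℕ → R → R → Ω → ℝ}

/-- The sign of `α - 1 / 2` that speaks for a correct assessment of `j`. -/
def trustSign [DecidableEq R] (L : Finset R) (j : R) : ℝ := if j ∈ L then 1 else -1

/-- The exponential weight of one observation. -/
noncomputable def obsFactor [DecidableEq R] (L : Finset R) (ε : ℝ) (j : R) (a : ℝ) : ℝ≥0∞ :=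
  ENNReal.ofReal (Real.exp (2 * ε ^ 2 - 4 * ε * (trustSign L j * (a - 1 / 2))))

lemma measurable_obsFactor [DecidableEq R] (L : Finset R) (ε : ℝ) (j : R) :
    Measurable (obsFactor L ε j) := by
  unfold obsFactor
  fun_prop

open Classical in
/-- The exponential supermartingale of the observations made by the pairs `J` at the times
`1, …, t`. -/
noncomputable def obsWeight (L : Finset R) (χ : ℕ → R → Ω → V) (α : ℕ → R → R → Ω → ℝ) (ε : ℝ)
    (J : Finset (ObsPair L)) (t : ℕ) (ω : Ω) : ℝ≥0∞ :=
  ∏ r ∈ Finset.Icc 1 t, ∏ p ∈ J,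
    if χ r p.1.2 ω = χ r p.1.1 ω then obsFactor L ε p.1.2 (α r p.1.1 p.1.2 ω) else 1

/-- The weights up to time `t` are part of any σ-algebra that contains the sites and observations
up to time `t`. -/
lemma measurable_obsWeight {Ω : Type*} {χ : ℕ → R → Ω → V} {α : ℕ → R → R → Ω → ℝ}
    [Fintype V] (m : MeasurableSpace Ω) (ε : ℝ) (J : Finset (ObsPair L))
    (t : ℕ) (hχ : ∀ r ≤ t, ∀ i v, MeasurableSet[m] {ω | χ r i ω = v})
    (hα : ∀ r ≤ t, ∀ p : ObsPair L, Measurable[m] (α r p.1.1 p.1.2)) :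
    Measurable[m] (obsWeight L χ α ε J t) := by
  classical
  refine Finset.measurable_prod _ fun r hr => Finset.measurable_prod _ fun p _ => ?_
  have hr' := (Finset.mem_Icc.1 hr).2
  refine Measurable.ite ?_ ((measurable_obsFactor L ε p.1.2).comp (hα r hr' p)) measurable_const
  have : {ω | χ r p.1.2 ω = χ r p.1.1 ω} =
      ⋃ v, {ω | χ r p.1.2 ω = v} ∩ {ω | χ r p.1.1 ω = v} := by
    ext ω
    simp [eq_comm]
  rw [this]
  exact MeasurableSet.iUnion fun v => (hχ r hr' _ v).inter (hχ r hr' _ v)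

namespace IsTeamProcess

variable {G : SimpleGraph V} {ε : ℝ} [IsProbabilityMeasure μ] (hX : IsTeamProcess μ G L ε χ α)
include hX

lemma lintegral_obsFactor_le_one [DecidableEq R] (hε : 0 ≤ ε) (t : ℕ) (p : ObsPair L) :
    ∫⁻ ω, obsFactor L ε p.1.2 (α t p.1.1 p.1.2 ω) ∂μ ≤ 1 := by
  refine lintegral_exp_obs_le_one (hX.measurable_obs t _ _)
    (hX.obs_range t _ p.2.1 _ p.2.2) hε ?_ ?_
  · unfold trustSign; split_ifs <;> norm_num
  · unfold trustSign
    split_ifs with h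
    · linarith [hX.obs_legit t _ p.2.1 _ h p.2.2]
    · linarith [hX.obs_malicious t _ p.2.1 _ h]

/-- At each step, the new observations are independent of each other and of the past, which
includes the present sites. -/
lemma lintegral_obsWeight_le_one [Fintype R] [Fintype V] (hε : 0 ≤ ε) (J : Finset (ObsPair L))
    (t : ℕ) : ∫⁻ ω, obsWeight L χ α ε J t ω ∂μ ≤ 1 := by
  classical
  induction t with
  | zero => simp [obsWeight]
  | succ t ih =>
    refine le_trans ?_ ih
    set site : (R → V) → Set Ω := fun v => {ω | ∀ i, χ (t + 1) i ω = v i} with hsite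
    set F : (R → V) → Ω → ℝ≥0∞ := fun v ω =>
      ∏ p ∈ J.filter fun p => v p.1.2 = v p.1.1, obsFactor L ε p.1.2 (α (t + 1) p.1.1 p.1.2 ω)
      with hF
    have hsm : ∀ v, MeasurableSet[record L χ α (t + 1) (t + 1)] (site v) := fun v => by
      have : site v = ⋂ i, {ω | χ (t + 1) i ω = v i} := by ext ω; simp [hsite]
      rw [this]
      exact @MeasurableSet.iInter _ _ (record L χ α (t + 1) (t + 1)) _ _ fun i =>
        measurableSet_record_site (L := L) (χ := χ) (α := α) le_rfl i (v i)
    have hZm : Measurable[record L χ α (t + 1) (t + 1)] (obsWeight L χ α ε J t) :=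
      measurable_obsWeight _ ε J t
        (fun r hr i v => measurableSet_record_site (L := L) (χ := χ) (α := α) (by omega) i v)
        fun r hr p => measurable_record_obs (L := L) (χ := χ) (α := α) (by omega) p
    have hle := hX.record_le (t + 1) (t + 1)
    have hZ1 : ∀ v, Measurable[record L χ α (t + 1) (t + 1)]
        ((site v).indicator (obsWeight L χ α ε J t)) := fun v => hZm.indicator (hsm v)
    have hFle : ∀ v, ∫⁻ ω, F v ω ∂μ ≤ 1 := by
      intro v
      have hind : iIndepFun (fun (p : ObsPair L) ω => obsFactor L ε p.1.2 (α (t + 1) p.1.1 p.1.2 ω)) μ :=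
        (hX.obs_indep (t + 1)).comp (fun p => obsFactor L ε p.1.2)
          fun p => measurable_obsFactor L ε p.1.2
      rw [hF, lintegral_prod_eq_prod_lintegral_of_indepFun _ _ hind fun p =>
        (measurable_obsFactor L ε p.1.2).comp (hX.measurable_obs _ _ _)]
      exact Finset.prod_le_one' fun p _ => hX.lintegral_obsFactor_le_one hε _ p
    have hdec : ∀ ω, obsWeight L χ α ε J (t + 1) ω =
        ∑ v, (site v).indicator (obsWeight L χ α ε J t) ω * F v ω := by
      intro ω
      rw [Finset.sum_eq_single fun i => χ (t + 1) i ω]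
      · rw [Set.indicator_of_mem (by simp [hsite]), obsWeight, Finset.prod_Icc_succ_top (by omega)]
        simp only [hF, Finset.prod_filter]
        rfl
      · intro v _ hv
        rw [Set.indicator_of_notMem, zero_mul]
        exact fun h => hv (funext fun i => (h i).symm)
      · simp
    have hFm : ∀ v, Measurable[⨆ p : ObsPair L,
        MeasurableSpace.comap (α (t + 1) p.1.1 p.1.2) (inferInstance : MeasurableSpace ℝ)] (F v) := by
      intro v
      refine Finset.measurable_prod _ fun p _ => (measurable_obsFactor L ε p.1.2).comp ?_
      exact measurable_iff_comap_le.2 (le_iSup (fun p : ObsPair L =>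
        MeasurableSpace.comap (α (t + 1) p.1.1 p.1.2) (inferInstance : MeasurableSpace ℝ)) p)
    have hobs : (⨆ p : ObsPair L, MeasurableSpace.comap (α (t + 1) p.1.1 p.1.2)
        (inferInstance : MeasurableSpace ℝ)) ≤ mΩ :=
      iSup_le fun p => measurable_iff_comap_le.1 (hX.measurable_obs _ _ _)
    calc ∫⁻ ω, obsWeight L χ α ε J (t + 1) ω ∂μ
        = ∑ v, ∫⁻ ω, (site v).indicator (obsWeight L χ α ε J t) ω * F v ω ∂μ := by
          simp only [hdec]
          exact lintegral_finsetSum _ fun v _ =>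
            ((hZ1 v).mono hle le_rfl).mul ((hFm v).mono hobs le_rfl)
      _ ≤ ∑ v, ∫⁻ ω, (site v).indicator (obsWeight L χ α ε J t) ω ∂μ := by
          refine Finset.sum_le_sum fun v _ => ?_
          rw [lintegral_mul_eq_lintegral_mul_lintegral_of_independent_measurableSpace hle hobs
            (hX.obs_indep_past (t + 1)) (hZ1 v) (hFm v)]
          exact mul_le_of_le_one_right' (hFle v)
      _ = ∫⁻ ω, obsWeight L χ α ε J t ω ∂μ := by
          rw [← lintegral_finsetSum _ fun v _ => (hZ1 v).mono hle le_rfl]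
          refine lintegral_congr fun ω => ?_
          rw [Finset.sum_eq_single fun i => χ (t + 1) i ω]
          · rw [Set.indicator_of_mem (by simp [hsite])]
          · exact fun v _ hv => Set.indicator_of_notMem
              (fun h => hv (funext fun i => (h i).symm)) _
          · simp

/-- It is exponentially unlikely that all pairs in `J` have enough observations and misjudge. -/
lemma measure_misjudge_le [Fintype R] [DecidableEq R] [Fintype V] [DecidableEq V] (hε : 0 ≤ ε)
    (J : Finset (ObsPair L)) (τ : ℕ) (n : ℝ) :
    μ.real {ω | ∀ p ∈ J,
      n ≤ ((obsTimes (fun t r => χ t r ω) τ p.1.1 p.1.2).card : ℝ) ∧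
      trustSign L p.1.2 *
        trustFn (fun t r => χ t r ω) (fun t r r' => α t r r' ω) τ p.1.1 p.1.2 ≤ 0} ≤
      Real.exp (-(2 * ε ^ 2 * n)) ^ J.card := by
  set A := {ω | ∀ p ∈ J,
      n ≤ ((obsTimes (fun t r => χ t r ω) τ p.1.1 p.1.2).card : ℝ) ∧
      trustSign L p.1.2 *
        trustFn (fun t r => χ t r ω) (fun t r r' => α t r r' ω) τ p.1.1 p.1.2 ≤ 0}
  have hZ : ∀ ω, obsWeight L χ α ε J τ ω = ∏ p ∈ J, ENNReal.ofReal (Real.exp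
      (2 * ε ^ 2 * ((obsTimes (fun t r => χ t r ω) τ p.1.1 p.1.2).card : ℝ) - 4 * ε *
        (trustSign L p.1.2 *
          trustFn (fun t r => χ t r ω) (fun t r r' => α t r r' ω) τ p.1.1 p.1.2))) := by
    intro ω
    rw [obsWeight, Finset.prod_comm]
    refine Finset.prod_congr rfl fun p _ => ?_
    have h1 : obsTimes (fun t r => χ t r ω) τ p.1.1 p.1.2 =
        (Finset.Icc 1 τ).filter fun t => χ t p.1.2 ω = χ t p.1.1 ω := by
      simp [obsTimes, neighbors]
    rw [trustFn, h1]
    have h2 := Finset.prod_filter (s := Finset.Icc 1 τ) (fun t => χ t p.1.2 ω = χ t p.1.1 ω)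
      fun t => obsFactor L ε p.1.2 (α t p.1.1 p.1.2 ω)
    have h3 : ∏ r ∈ Finset.Icc 1 τ, (if χ r p.1.2 ω = χ r p.1.1 ω then
        obsFactor L ε p.1.2 (α r p.1.1 p.1.2 ω) else 1) =
        ∏ t ∈ (Finset.Icc 1 τ).filter fun t => χ t p.1.2 ω = χ t p.1.1 ω,
          obsFactor L ε p.1.2 (α t p.1.1 p.1.2 ω) := by
      rw [h2]
    refine Eq.trans ?_ (h3.trans ?_)
    · exact Finset.prod_congr rfl fun r _ => by congr
    · simp only [obsFactor]
      rw [← ENNReal.ofReal_prod_of_nonneg fun _ _ => (Real.exp_pos _).le, ← Real.exp_sum]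
      congr 2
      rw [Finset.sum_sub_distrib, ← Finset.mul_sum, ← Finset.mul_sum, ← Finset.mul_sum,
        Finset.sum_const, nsmul_eq_mul]
      ring
  have hsub : A ⊆ {ω | ENNReal.ofReal (Real.exp (2 * ε ^ 2 * n)) ^ J.card ≤
      obsWeight L χ α ε J τ ω} := by
    intro ω hω
    rw [Set.mem_ofPred_eq, hZ, ← Finset.prod_const]
    refine Finset.prod_le_prod' fun p hp => ENNReal.ofReal_le_ofReal (Real.exp_le_exp.2 ?_)
    obtain ⟨h1, h2⟩ := hω p hp
    have h3 := mul_le_mul_of_nonneg_left h1 (by positivity : (0 : ℝ) ≤ 2 * ε ^ 2)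
    have h4 := mul_nonneg (by positivity : (0 : ℝ) ≤ 4 * ε) (neg_nonneg.2 h2)
    linarith
  have hm : Measurable (obsWeight L χ α ε J τ) := measurable_obsWeight mΩ ε J τ
    (fun r _ i v => hX.record_le r 0 _ (measurableSet_record_site le_rfl i v))
    fun r _ p => hX.measurable_obs r _ _
  have h1 := (mul_meas_ge_le_lintegral hm
    (ENNReal.ofReal (Real.exp (2 * ε ^ 2 * n)) ^ J.card)).trans
    (hX.lintegral_obsWeight_le_one hε J τ)
  have h2 := (mul_le_mul_right (measure_mono (μ := μ) hsub)
    (ENNReal.ofReal (Real.exp (2 * ε ^ 2 * n)) ^ J.card)).trans h1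
  have h3 := ENNReal.toReal_mono ENNReal.one_ne_top h2
  rw [ENNReal.toReal_mul, ENNReal.toReal_pow, ENNReal.toReal_ofReal (Real.exp_pos _).le,
    ENNReal.toReal_one] at h3
  rw [Real.exp_neg, inv_pow, ← one_div, le_div_iff₀ (by positivity), mul_comm]
  exact h3

end IsTeamProcess

end Observations

/-! ### The majority vote -/

section Majority

variable {R V : Type*} [Fintype R] [DecidableEq R] [DecidableEq V] {L : Finset R}
  {χ : ℕ → R → V} {α : ℕ → R → R → ℝ} {τ : ℕ} {n : ℝ}

lemma mem_obsTimes {i j : R} {t : ℕ} :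
    t ∈ obsTimes χ τ i j ↔ t ∈ Finset.Icc 1 τ ∧ χ t j = χ t i := by
  simp [obsTimes, neighbors]

lemma obsTimes_comm (i j : R) : obsTimes χ τ i j = obsTimes χ τ j i := by
  ext t
  rw [mem_obsTimes, mem_obsTimes, eq_comm (a := χ t j)]

/-- The observer of the pair `p` has enough observations, but they point to the wrong side. -/
def Misjudges (L : Finset R) (χ : ℕ → R → V) (α : ℕ → R → R → ℝ) (τ : ℕ) (n : ℝ)
    (p : ObsPair L) : Prop :=
  n ≤ ((obsTimes χ τ p.1.1 p.1.2).card : ℝ) ∧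
    trustSign L p.1.2 * trustFn χ α τ p.1.1 p.1.2 ≤ 0

lemma interim_eq_true_iff {i j : R} : interim χ α τ n i j = true ↔
    j = i ∨ (n ≤ ((obsTimes χ τ i j).card : ℝ) ∧ 0 ≤ trustFn χ α τ i j) := by
  simp [interim]

lemma misjudges_of_legit {i j : R} (hi : i ∈ L) (hj : j ∈ L) (hij : i ≠ j)
    (hn : n ≤ ((obsTimes χ τ i j).card : ℝ)) (h : interim χ α τ n i j ≠ true) :
    Misjudges L χ α τ n ⟨(i, j), hi, hij⟩ := by
  refine ⟨hn, ?_⟩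
  rw [Ne, interim_eq_true_iff, not_or, not_and, not_le] at h
  simpa [trustSign, hj] using (h.2 hn).le

lemma misjudges_of_malicious {i j : R} (hi : i ∈ L) (hj : j ∉ L)
    (h : interim χ α τ n i j = true) :
    Misjudges L χ α τ n ⟨(i, j), hi, fun e : i = j => hj (e ▸ hi)⟩ := by
  rw [interim_eq_true_iff] at h
  obtain ⟨h1, h2⟩ := h.resolve_left fun e => hj (e ▸ hi)
  exact ⟨h1, by simpa [trustSign, hj] using h2⟩

lemma mem_trusted {i j : R} : j ∈ trusted χ α τ n i ↔
    (∃ t ∈ Finset.Icc τ (2 * τ), χ t j = χ t i) ∧ interim χ α τ n i j = true := by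
  have : 2 * τ - τ = τ := by omega
  simp only [trusted, windowNeighbors, this, Finset.mem_filter, Finset.mem_biUnion, neighbors,
    Finset.mem_univ, true_and]

lemma card_le_of_forall_exists {α β : Type*} {s : Finset α} {t : Finset β} (f : β → α)
    (h : ∀ a ∈ s, ∃ b ∈ t, f b = a) : s.card ≤ t.card := by
  classical
  exact (Finset.card_le_card fun a ha => Finset.mem_image.2 (h a ha)).trans Finset.card_image_le

open Classical in
/-- If every kind of failure concerns fewer than one eighth of `L.card` robots, then more than
`5 / 8` of the legitimate robots are trusted, fewer than `1 / 8` as many malicious ones are, and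
fewer than `2 / 8` of the legitimate robots hold a wrong opinion on a given robot (fewer than
`1 / 8` if that robot is malicious). -/
lemma finalTrust_correct
    (few_obs : ∀ i : L, 8 * (Finset.univ.filter fun j : L =>
      j ≠ i ∧ ((obsTimes χ τ i j).card : ℝ) < n).card < L.card)
    (few_met : ∀ i : L, 8 * (Finset.univ.filter fun j : L =>
      j ≠ i ∧ ∀ t ∈ Finset.Icc τ (2 * τ), χ t j ≠ χ t i).card < L.card)
    (few_legit : ∀ i : L, 8 * ((Finset.univ.filter fun p : ObsPair L =>
      p.1.1 = i ∧ p.1.2 ∈ L).filter (Misjudges L χ α τ n)).card < L.card)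
    (few_malicious : ∀ i : L, 8 * ((Finset.univ.filter fun p : ObsPair L =>
      p.1.1 = i ∧ p.1.2 ∉ L).filter (Misjudges L χ α τ n)).card < L.card)
    (few_observers : ∀ k : R, 8 * ((Finset.univ.filter fun p : ObsPair L =>
      p.1.2 = k).filter (Misjudges L χ α τ n)).card < L.card)
    (rep : R → R → R → Bool) {i : R} (hi : i ∈ L) (k : R) :
    finalTrust L χ α τ n rep i k = true ↔ k ∈ L := by
  set Θ := trusted χ α τ n i with hΘ
  have hmiss : 8 * (L \ Θ).card < 3 * L.card := by
    have hsub : L \ Θ ⊆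
        ((Finset.univ.filter fun j : L =>
          j ≠ ⟨i, hi⟩ ∧ ((obsTimes χ τ i j).card : ℝ) < n).image Subtype.val ∪
        (Finset.univ.filter fun j : L =>
          j ≠ ⟨i, hi⟩ ∧ ∀ t ∈ Finset.Icc τ (2 * τ), χ t j ≠ χ t i).image Subtype.val) ∪
        ((Finset.univ.filter fun p : ObsPair L =>
          p.1.1 = i ∧ p.1.2 ∈ L).filter (Misjudges L χ α τ n)).image fun p => p.1.2 := by
      intro j hj
      obtain ⟨hjL, hjΘ⟩ := Finset.mem_sdiff.1 hj
      have hji : j ≠ i := by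
        rintro rfl
        exact hjΘ (mem_trusted.2 ⟨⟨τ, by simp; omega, rfl⟩, interim_eq_true_iff.2 (Or.inl rfl)⟩)
      simp only [Finset.mem_union, Finset.mem_image, Finset.mem_filter, Finset.mem_univ, true_and]
      by_cases h1 : ((obsTimes χ τ i j).card : ℝ) < n
      · exact Or.inl (Or.inl ⟨⟨j, hjL⟩, ⟨by simpa using hji, h1⟩, rfl⟩)
      by_cases h2 : ∀ t ∈ Finset.Icc τ (2 * τ), χ t j ≠ χ t i
      · exact Or.inl (Or.inr ⟨⟨j, hjL⟩, ⟨by simpa using hji, h2⟩, rfl⟩)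
      refine Or.inr ⟨_, ⟨⟨rfl, hjL⟩,
        misjudges_of_legit hi hjL hji.symm (not_lt.1 h1) fun h3 => hjΘ (mem_trusted.2 ⟨?_, h3⟩)⟩, rfl⟩
      push Not at h2
      exact h2
    have h1 := Finset.card_le_card hsub
    have h2 := (Finset.card_union_le _ _).trans (Nat.add_le_add (Finset.card_union_le
      ((Finset.univ.filter fun j : L =>
          j ≠ ⟨i, hi⟩ ∧ ((obsTimes χ τ i j).card : ℝ) < n).image Subtype.val)
      ((Finset.univ.filter fun j : L =>
          j ≠ ⟨i, hi⟩ ∧ ∀ t ∈ Finset.Icc τ (2 * τ), χ t j ≠ χ t i).image Subtype.val))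
      (Finset.card_image_le (s := (Finset.univ.filter fun p : ObsPair L =>
          p.1.1 = i ∧ p.1.2 ∈ L).filter (Misjudges L χ α τ n)) (f := fun p => p.1.2)))
    have h3 := Finset.card_image_le (s := Finset.univ.filter fun j : L =>
          j ≠ ⟨i, hi⟩ ∧ ((obsTimes χ τ i j).card : ℝ) < n) (f := Subtype.val)
    have h4 := Finset.card_image_le (s := Finset.univ.filter fun j : L =>
          j ≠ ⟨i, hi⟩ ∧ ∀ t ∈ Finset.Icc τ (2 * τ), χ t j ≠ χ t i) (f := Subtype.val)
    have h5 := few_obs ⟨i, hi⟩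
    have h6 := few_met ⟨i, hi⟩
    have h7 := few_legit ⟨i, hi⟩
    dsimp only at h5 h6 h7
    omega
  have hmal : 8 * (Θ \ L).card < L.card := by
    refine lt_of_le_of_lt (Nat.mul_le_mul_left 8 (card_le_of_forall_exists (fun p => p.1.2) ?_))
      (few_malicious ⟨i, hi⟩)
    intro j hj
    obtain ⟨hjΘ, hjL⟩ := Finset.mem_sdiff.1 hj
    have hmis := misjudges_of_malicious hi hjL (mem_trusted.1 hjΘ).2
    exact ⟨_, Finset.mem_filter.2 ⟨Finset.mem_filter.2 ⟨Finset.mem_univ _, rfl, hjL⟩, hmis⟩, rfl⟩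
  have hcard : L.card = (L \ Θ).card + (Θ ∩ L).card := by
    rw [Finset.inter_comm, Finset.card_sdiff_add_card_inter]
  have hΘcard : Θ.card = (Θ \ L).card + (Θ ∩ L).card := by
    rw [Finset.card_sdiff_add_card_inter]
  set Y := Θ.filter fun j => shared L χ α τ n rep i j k = true with hY
  have hsum : ∑ j ∈ Θ, (if shared L χ α τ n rep i j k = true then (1 : ℝ) else 0) = Y.card := by
    rw [Finset.sum_boole]
  have hiff : finalTrust L χ α τ n rep i k = true ↔ Θ.card ≤ 2 * Y.card := by
    rw [finalTrust, decide_eq_true_iff, ← hΘ]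
    have e : (∑ j ∈ Θ, (if shared L χ α τ n rep i j k = true then (1 : ℝ) else 0)) = Y.card := hsum
    rw [e, div_le_iff₀ two_pos, mul_comm]
    exact_mod_cast Iff.rfl
  rw [hiff]
  constructor
  · intro h
    by_contra hk
    have hYs : Y ⊆ (Θ \ L) ∪ ((Finset.univ.filter fun p : ObsPair L =>
        p.1.2 = k).filter (Misjudges L χ α τ n)).image fun p => p.1.1 := by
      intro j hj
      obtain ⟨hjΘ, hjs⟩ := Finset.mem_filter.1 hj
      by_cases hjL : j ∈ L
      · rw [shared, if_pos hjL] at hjs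
        refine Finset.mem_union_right _ (Finset.mem_image.2
          ⟨⟨(j, k), hjL, fun e : j = k => hk (e ▸ hjL)⟩, ?_, rfl⟩)
        simpa using misjudges_of_malicious hjL hk hjs
      · exact Finset.mem_union_left _ (Finset.mem_sdiff.2 ⟨hjΘ, hjL⟩)
    have h1 := (Finset.card_le_card hYs).trans ((Finset.card_union_le _ _).trans
      (Nat.add_le_add_left Finset.card_image_le _))
    have h2 := few_observers k
    omega
  · intro hk
    have hYs : (Θ ∩ L) ⊆ (Y ∪ (Finset.univ.filter fun j : L =>
          j ≠ ⟨k, hk⟩ ∧ ((obsTimes χ τ k j).card : ℝ) < n).image Subtype.val) ∪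
        ((Finset.univ.filter fun p : ObsPair L =>
        p.1.2 = k).filter (Misjudges L χ α τ n)).image fun p => p.1.1 := by
      intro j hj
      obtain ⟨hjΘ, hjL⟩ := Finset.mem_inter.1 hj
      simp only [Finset.mem_union, Finset.mem_image, Finset.mem_filter, Finset.mem_univ, true_and]
      by_cases h0 : interim χ α τ n j k = true
      · exact Or.inl (Or.inl (Finset.mem_filter.2 ⟨hjΘ, by rw [shared, if_pos hjL, h0]⟩))
      have hjk : k ≠ j := fun e => h0 (interim_eq_true_iff.2 (Or.inl e))
      by_cases h1 : ((obsTimes χ τ k j).card : ℝ) < n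
      · exact Or.inl (Or.inr ⟨⟨j, hjL⟩, ⟨by simpa using hjk.symm, h1⟩, rfl⟩)
      rw [obsTimes_comm, not_lt] at h1
      exact Or.inr ⟨_, ⟨rfl, misjudges_of_legit hjL hk hjk.symm h1 h0⟩, rfl⟩
    have h1 := (Finset.card_le_card hYs).trans ((Finset.card_union_le _ _).trans
      (Nat.add_le_add ((Finset.card_union_le _ _).trans
      (Nat.add_le_add_left Finset.card_image_le _)) Finset.card_image_le))
    have h2 := few_observers k
    have h3 := few_obs ⟨k, hk⟩
    dsimp only at h3
    omega

end Majority

/-! ### Counting failures -/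

section Counting

variable {Ω : Type*} [MeasurableSpace Ω] {μ : Measure Ω} [IsProbabilityMeasure μ]

open Classical in
/-- If any `m` of the events `B j`, `j ∈ U`, happen together with probability at most `p ^ m`, then
at least `m` of them happen with probability at most `(U.card.choose m) * p ^ m`. -/
lemma measure_card_ge_le {ι : Type*} (U : Finset ι) (B : ι → Ω → Prop) (m : ℕ) {p : ℝ}
    (h : ∀ J ⊆ U, J.card = m → μ.real {ω | ∀ j ∈ J, B j ω} ≤ p ^ m) :
    μ.real {ω | m ≤ (U.filter fun j => B j ω).card} ≤ (U.card.choose m : ℝ) * p ^ m := by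
  have hsub : {ω | m ≤ (U.filter fun j => B j ω).card} ⊆
      ⋃ J ∈ U.powersetCard m, {ω | ∀ j ∈ J, B j ω} := by
    intro ω hω
    obtain ⟨J, hJ, hc⟩ := Finset.exists_subset_card_eq (Set.mem_ofPred_eq ▸ hω)
    refine Set.mem_iUnion₂.2 ⟨J, Finset.mem_powersetCard.2
      ⟨hJ.trans (Finset.filter_subset _ _), hc⟩, fun j hj => (Finset.mem_filter.1 (hJ hj)).2⟩
  refine (measureReal_mono hsub (measure_ne_top _ _)).trans ((measureReal_biUnion_finset_le _ _).trans ?_)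
  refine (Finset.sum_le_sum fun J hJ => ?_).trans_eq (b := ∑ J ∈ U.powersetCard m, p ^ m) ?_
  · obtain ⟨h1, h2⟩ := Finset.mem_powersetCard.1 hJ
    exact h J h1 h2
  · rw [Finset.sum_const, Finset.card_powersetCard, nsmul_eq_mul]

end Counting

/-- The constant `10 * e ^ (2 * e)`, so that `qVal δ N l = δ / (slack * N) * l`. -/
noncomputable def slack : ℝ := 10 * Real.exp (2 * Real.exp 1)

lemma qVal_eq (δ : ℝ) (N l : ℕ) : qVal δ N l = δ / (slack * N) * l := by
  unfold qVal rho1 slack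
  field_simp

lemma eight_mul_exp_le_slack : 8 * Real.exp 1 ≤ slack := by
  have h1 : Real.exp 1 ≤ Real.exp (2 * Real.exp 1) := by
    refine Real.exp_le_exp.2 ?_
    linarith [Real.add_one_le_exp 1]
  unfold slack
  linarith [Real.exp_pos 1]

lemma ten_le_slack : 10 ≤ slack := by linarith [eight_mul_exp_le_slack, Real.add_one_le_exp 1,
  Real.exp_one_gt_d9]

/-- The union bound over the sets of `m ≥ l / 8` failures: one factor `q ^ m`, where `q = r * l`,
pays for the choice of the set, and `q ^ (24 * m) ≤ q ^ (3 * l) ≤ r ^ 3`. -/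
lemma choose_mul_pow_le {N l m : ℕ} {r p : ℝ} (hl : 1 ≤ l) (hN : 1 ≤ N) (hm : l ≤ 8 * m)
    (hr : 0 ≤ r) (hrN : r * N ≤ 1 / slack) (hlN : l ≤ N) (hp0 : 0 ≤ p) (hp : p ≤ (r * l) ^ 25) :
    (N.choose m : ℝ) * p ^ m ≤ r ^ 3 := by
  have hs := ten_le_slack
  have hlr : (0 : ℝ) < l := by exact_mod_cast hl
  have hlN' : (l : ℝ) ≤ N := by exact_mod_cast hlN
  have hm' : (l : ℝ) ≤ 8 * m := by exact_mod_cast hm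
  have hmr : (0 : ℝ) < m := by linarith
  have hq0 : 0 ≤ r * l := by positivity
  have hq1 : r * l ≤ 1 / slack := (mul_le_mul_of_nonneg_left hlN' hr).trans hrN
  have hq2 : r * l ≤ 1 / 2 := hq1.trans (one_div_le_one_div_of_le (by norm_num) (by linarith))
  have hchoose : (N.choose m : ℝ) * (r * l) ^ m ≤ 1 := by
    have h1 : (N.choose m : ℝ) ≤ (N : ℝ) ^ m / (m.factorial : ℝ) := Nat.choose_le_pow_div m N
    have h2 : (m : ℝ) ^ m / (m.factorial : ℝ) ≤ Real.exp m :=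
      Real.pow_div_factorial_le_exp _ hmr.le m
    have hf : (0 : ℝ) < m.factorial := by exact_mod_cast m.factorial_pos
    have h3 : (N : ℝ) ^ m * (r * l) ^ m ≤ m.factorial := by
      rw [div_le_iff₀ hf] at h2
      have e : Real.exp m = Real.exp 1 ^ m := by rw [← Real.exp_nat_mul, mul_one]
      have h4 : ((N : ℝ) * (r * l) * Real.exp 1) ^ m ≤ (m : ℝ) ^ m := by
        refine pow_le_pow_left₀ (by positivity) ?_ m
        have h5 : r * N * (8 * Real.exp 1) ≤ 1 := by
          calc r * N * (8 * Real.exp 1) ≤ 1 / slack * slack :=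
                mul_le_mul hrN eight_mul_exp_le_slack (by positivity) (by positivity)
            _ = 1 := by rw [one_div, inv_mul_cancel₀ (by linarith)]
        nlinarith
      rw [mul_pow, mul_pow] at h4
      rw [e] at h2
      have h6 := h4.trans h2
      rw [mul_comm (Real.exp 1 ^ m)] at h6
      exact le_of_mul_le_mul_right h6 (by positivity)
    calc (N.choose m : ℝ) * (r * l) ^ m ≤ (N : ℝ) ^ m / (m.factorial : ℝ) * (r * l) ^ m :=
          mul_le_mul_of_nonneg_right h1 (by positivity)
      _ = (N : ℝ) ^ m * (r * l) ^ m / m.factorial := by ring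
      _ ≤ 1 := by rw [div_le_one hf]; exact h3
  have hql : (r * l) ^ l ≤ r := by
    obtain ⟨k, rfl⟩ : ∃ k, l = k + 1 := ⟨l - 1, by omega⟩
    have h1 : ((k + 1 : ℕ) : ℝ) * (r * (k + 1 : ℕ)) ^ k ≤ 1 := by
      have h2 : ((k + 1 : ℕ) : ℝ) ≤ 2 ^ k := by exact_mod_cast Nat.lt_two_pow_self
      calc ((k + 1 : ℕ) : ℝ) * (r * (k + 1 : ℕ)) ^ k ≤ 2 ^ k * (1 / 2) ^ k :=
            mul_le_mul h2 (pow_le_pow_left₀ hq0 hq2 k) (by positivity) (by positivity)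
        _ = 1 := by rw [← mul_pow]; norm_num
    calc (r * (k + 1 : ℕ)) ^ (k + 1)
        = r * (((k + 1 : ℕ) : ℝ) * (r * (k + 1 : ℕ)) ^ k) := by ring
      _ ≤ r := mul_le_of_le_one_right hr h1
  calc (N.choose m : ℝ) * p ^ m ≤ (N.choose m : ℝ) * ((r * l) ^ 25) ^ m := by gcongr
    _ = ((N.choose m : ℝ) * (r * l) ^ m) * (r * l) ^ (24 * m) := by
        rw [← pow_mul, show 25 * m = m + 24 * m by ring, pow_add]; ring
    _ ≤ (r * l) ^ (24 * m) := mul_le_of_le_one_left (by positivity) hchoose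
    _ ≤ (r * l) ^ (l * 3) := pow_le_pow_of_le_one hq0 (by linarith) (by omega)
    _ = ((r * l) ^ l) ^ 3 := by rw [pow_mul]
    _ ≤ r ^ 3 := pow_le_pow_left₀ (by positivity) hql 3

/-! ### Failure probabilities -/

section Failure

lemma nAlpha_eq (ε δ : ℝ) (N l : ℕ) :
    nAlpha ε δ N l = 80 / ε ^ 2 * Real.log (1 / qVal δ N l) := by
  unfold nAlpha rho1
  congr 1
  rw [one_div, ← div_div, div_inv_eq_mul]
  norm_num

/-- `w ≥ 8 n'` windows outweigh the factor `2 ^ n` in the bound for fewer than `n` meetings. -/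
lemma two_rpow_mul_pow_le {ε x n : ℝ} {w : ℕ} (hε : 0 < ε) (hε' : ε ≤ 1 / 2) (hx : 0 < x)
    (hx1 : x ≤ 1) (hn : n ≤ 80 / ε ^ 2 * Real.log (1 / x))
    (hw : 8 * (80 / ε ^ 2 * Real.log (1 / x)) ≤ w) : 2 ^ n * (7 / 8 : ℝ) ^ w ≤ x ^ 25 := by
  set y := Real.log (1 / x) with hy
  have hlog : y = -Real.log x := by rw [hy, one_div, Real.log_inv]
  have hy0 : 0 ≤ y := by rw [hlog]; linarith [Real.log_nonpos hx.le hx1]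
  have hε2 : 320 ≤ 80 / ε ^ 2 := by
    rw [le_div_iff₀ (by positivity)]
    nlinarith
  have hbig : 320 * y ≤ 80 / ε ^ 2 * y := mul_le_mul_of_nonneg_right hε2 hy0
  have h1 : (2 : ℝ) ^ n = Real.exp (Real.log 2 * n) := Real.rpow_def_of_pos two_pos n
  have h2 : (7 / 8 : ℝ) ^ w ≤ Real.exp (-(w / 8)) := by
    have : (7 / 8 : ℝ) ≤ Real.exp (-(1 / 8)) := by
      linarith [Real.add_one_le_exp (-(1 / 8) : ℝ)]
    refine (pow_le_pow_left₀ (by norm_num) this w).trans_eq ?_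
    rw [← Real.exp_nat_mul]
    congr 1
    ring
  have h3 : x ^ 25 = Real.exp (-(25 * y)) := by
    rw [hlog]
    nth_rw 1 [← Real.exp_log hx]
    rw [← Real.exp_nat_mul]
    congr 1
    push_cast
    ring
  rw [h3]
  refine (mul_le_mul h1.le h2 (by positivity) (Real.exp_pos _).le).trans ?_
  rw [← Real.exp_add, Real.exp_le_exp]
  have h4 : Real.log 2 * n ≤ Real.log 2 * (80 / ε ^ 2 * y) :=
    mul_le_mul_of_nonneg_left hn (Real.log_pos one_lt_two).le
  have h5 : Real.log 2 * (80 / ε ^ 2 * y) ≤ 0.7 * (80 / ε ^ 2 * y) :=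
    mul_le_mul_of_nonneg_right (by linarith [Real.log_two_lt_d9]) (by linarith)
  linarith

lemma exp_neg_nAlpha_le {ε x : ℝ} (hε : 0 < ε) (hx : 0 < x) (hx1 : x ≤ 1) :
    Real.exp (-(2 * ε ^ 2 * (80 / ε ^ 2 * Real.log (1 / x)))) ≤ x ^ 25 := by
  have e : 2 * ε ^ 2 * (80 / ε ^ 2 * Real.log (1 / x)) = -(160 * Real.log x) := by
    rw [one_div, Real.log_inv]
    field_simp
    ring
  rw [e, neg_neg]
  nth_rw 2 [← Real.exp_log hx]
  rw [← Real.exp_nat_mul, Real.exp_le_exp]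
  have := Real.log_nonpos hx.le hx1
  push_cast
  linarith

lemma meetCount_le_card {Ω R V : Type*} {χ : ℕ → R → Ω → V} {s t : ℕ} {i j : R} {ω : Ω}
    (T : Finset ℕ) (h : ∀ r < t, χ (s + 1 + r) j ω = χ (s + 1 + r) i ω → s + 1 + r ∈ T) :
    meetCount χ s t i j ω ≤ T.card := by
  classical
  refine Finset.card_le_card_of_injOn (fun r => s + 1 + r) (fun r hr => ?_)
    fun a _ b _ hab => Nat.add_left_cancel hab
  obtain ⟨h1, h2⟩ := Finset.mem_filter.1 hr
  exact h r (Finset.mem_range.1 h1) h2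

lemma meetCount_eq_zero {Ω R V : Type*} {χ : ℕ → R → Ω → V} {t τ : ℕ} (h : t ≤ τ) {i j : R}
    {ω : Ω} (hne : ∀ r ∈ Finset.Icc τ (2 * τ), χ r j ω ≠ χ r i ω) : meetCount χ τ t i j ω = 0 :=
  Nat.le_zero.1 (meetCount_le_card ∅ fun r hr e =>
    absurd e (hne _ (Finset.mem_Icc.2 ⟨by omega, by omega⟩)))

lemma meetCount_le_card_obsTimes {Ω R V : Type*} [Fintype R] [DecidableEq R]
    [DecidableEq V] {χ : ℕ → R → Ω → V} {t τ : ℕ} (h : t ≤ τ) (i j : R) (ω : Ω) :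
    meetCount χ 0 t i j ω ≤ (obsTimes (fun t r => χ t r ω) τ i j).card :=
  meetCount_le_card _ fun r hr e =>
    mem_obsTimes.2 ⟨Finset.mem_Icc.2 ⟨by omega, by omega⟩, e⟩

variable {Ω R V : Type*} [MeasurableSpace Ω] {μ : Measure Ω} [IsProbabilityMeasure μ]
  [Fintype R] [DecidableEq R] [Fintype V] {G : SimpleGraph V} {L : Finset R}
  {ε δ : ℝ} {χ : ℕ → R → Ω → V} {α : ℕ → R → R → Ω → ℝ}

/-- The least number of failures that is not less than `l / 8`. -/
def failBound (l : ℕ) : ℕ := (l + 7) / 8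

open Classical in
/-- In every phase of length `t`, each legitimate robot meets all but less than one eighth of the
others at least `n` times, up to a failure probability `c`. -/
def MeetsOften (μ : Measure Ω) (L : Finset R) (χ : ℕ → R → Ω → V) (t : ℕ) (n c : ℝ) : Prop :=
  ∀ (s : ℕ) (i : L), μ.real {ω | failBound L.card ≤ (Finset.univ.filter fun j : L =>
    j ≠ i ∧ (meetCount χ s t i j ω : ℝ) < n).card} ≤ c

namespace IsTeamProcess

variable (hX : IsTeamProcess μ G L ε χ α)
include hX

open Classical in
lemma measure_many_misjudge_le [DecidableEq V] {N : ℕ} (hN : Fintype.card R = N) (hL : L.Nonempty) (hε : 0 < ε)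
    (hδ : 0 < δ) (hδ1 : δ ≤ 1) (τ : ℕ) (U : Finset (ObsPair L)) (hU : U.card ≤ N) :
    μ.real {ω | failBound L.card ≤ (U.filter fun p => Misjudges L (fun t r => χ t r ω)
      (fun t r r' => α t r r' ω) τ (nAlpha ε δ N L.card) p).card} ≤ (δ / (slack * N)) ^ 3 := by
  have hs := ten_le_slack
  have hl1 : 1 ≤ L.card := hL.card_pos
  have hlN : L.card ≤ N := hN ▸ L.card_le_univ
  have hN0 : (0 : ℝ) < N := by exact_mod_cast hl1.trans hlN
  have hlr : (0 : ℝ) < L.card := by exact_mod_cast hl1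
  have hlNr : (L.card : ℝ) ≤ N := by exact_mod_cast hlN
  set r := δ / (slack * N) with hr
  have hr0 : 0 < r := by positivity
  have hrN : r * N ≤ 1 / slack := by
    rw [hr, div_mul_eq_mul_div, mul_div_mul_right _ _ hN0.ne']
    exact div_le_div_of_nonneg_right hδ1 (by linarith)
  have hq1 : r * L.card ≤ 1 := ((mul_le_mul_of_nonneg_left hlNr hr0.le).trans hrN).trans
    ((div_le_one (by linarith)).2 (by linarith))
  have hp : Real.exp (-(2 * ε ^ 2 * nAlpha ε δ N L.card)) ≤ (r * L.card) ^ 25 := by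
    rw [nAlpha_eq, qVal_eq]
    exact exp_neg_nAlpha_le hε (by positivity) hq1
  refine (measure_card_ge_le U _ (failBound L.card)
    (p := Real.exp (-(2 * ε ^ 2 * nAlpha ε δ N L.card))) fun J _ hJ => ?_).trans ?_
  · rw [← hJ]
    exact hX.measure_misjudge_le hε.le J τ _
  · refine le_trans ?_ (choose_mul_pow_le (m := failBound L.card) hl1 (hl1.trans hlN)
      (by unfold failBound; omega) hr0.le hrN hlN (Real.exp_pos _).le hp)
    exact mul_le_mul_of_nonneg_right (by exact_mod_cast Nat.choose_le_choose _ hU) (by positivity)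

/-- All kinds of failure together have probability at most `5 * N * r ^ 3 ≤ δ / N`. -/
lemma measure_correct_ge [DecidableEq V] {N : ℕ} (hN : Fintype.card R = N) (hL : L.Nonempty) (hε : 0 < ε)
    (hδ : 0 < δ) (hδ1 : δ ≤ 1) {t τ : ℕ} (ht : t ≤ τ)
    (hmeet : MeetsOften μ L χ t (nAlpha ε δ N L.card) ((δ / (slack * N)) ^ 3)) :
    1 - δ / N ≤ μ.real {ω | ∀ (rep : R → R → R → Bool), ∀ i ∈ L, ∀ k : R,
      finalTrust L (fun t r => χ t r ω) (fun t r r' => α t r r' ω) τ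
        (nAlpha ε δ N L.card) rep i k = true ↔ k ∈ L} := by
  classical
  have hs := ten_le_slack
  have hl1 : 1 ≤ L.card := hL.card_pos
  have hlN : L.card ≤ N := hN ▸ L.card_le_univ
  have hN1 : (1 : ℝ) ≤ N := by exact_mod_cast hl1.trans hlN
  have hlr : (0 : ℝ) < L.card := by exact_mod_cast hl1
  have hlNr : (L.card : ℝ) ≤ N := by exact_mod_cast hlN
  set n := nAlpha ε δ N L.card with hn
  set r := δ / (slack * N) with hr
  have hr0 : 0 < r := by positivity
  have hrN : r * N = δ / slack := by
    rw [hr, div_mul_eq_mul_div, mul_div_mul_right _ _ (by linarith)]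
  have hn0 : 0 < n := by
    rw [hn, nAlpha_eq, qVal_eq, ← hr]
    have h1 : r * L.card < 1 := by
      refine ((mul_le_mul_of_nonneg_left hlNr hr0.le).trans_eq hrN).trans_lt ?_
      rw [div_lt_one (by linarith)]
      linarith
    have := Real.log_pos (one_lt_one_div (by positivity) h1)
    positivity
  set E₁ : L → Set Ω := fun i => {ω | failBound L.card ≤ (Finset.univ.filter fun j : L =>
    j ≠ i ∧ (meetCount χ 0 t i j ω : ℝ) < n).card} with hE₁
  set E₂ : L → Set Ω := fun i => {ω | failBound L.card ≤ (Finset.univ.filter fun j : L =>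
    j ≠ i ∧ (meetCount χ τ t i j ω : ℝ) < n).card} with hE₂
  set M : Finset (ObsPair L) → Set Ω := fun U => {ω | failBound L.card ≤
    (U.filter fun p => Misjudges L (fun t r => χ t r ω)
      (fun t r r' => α t r r' ω) τ n p).card} with hM
  set U₁ : L → Finset (ObsPair L) := fun i =>
    Finset.univ.filter fun p => p.1.1 = i ∧ p.1.2 ∈ L with hU₁
  set U₂ : L → Finset (ObsPair L) := fun i =>
    Finset.univ.filter fun p => p.1.1 = i ∧ p.1.2 ∉ L with hU₂
  set U₃ : R → Finset (ObsPair L) := fun k => Finset.univ.filter fun p => p.1.2 = k with hU₃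
  set good : Set Ω := {ω | ∀ (rep : R → R → R → Bool), ∀ i ∈ L, ∀ k : R,
      finalTrust L (fun t r => χ t r ω) (fun t r r' => α t r r' ω) τ n rep i k = true ↔ k ∈ L}
  -- fewer than `⌈l / 8⌉` means fewer than `l / 8`
  have hlt : ∀ c, c < failBound L.card → 8 * c < L.card := by unfold failBound; omega
  -- measurability of the good event is not needed: the failures cover its complement
  have hcover : Set.univ ⊆ good ∪ ((⋃ i, (E₁ i ∪ E₂ i) ∪ (M (U₁ i) ∪ M (U₂ i))) ∪ ⋃ k, M (U₃ k)) := by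
    intro ω _
    by_contra hω
    simp only [Set.mem_union, Set.mem_iUnion, not_or, not_exists] at hω
    obtain ⟨hg, hi, hk⟩ := hω
    refine hg fun rep i hiL k => finalTrust_correct (fun i => hlt _ ?_) (fun i => hlt _ ?_)
      (fun i => hlt _ (not_le.1 (hi i).2.1)) (fun i => hlt _ (not_le.1 (hi i).2.2))
      (fun k => hlt _ (not_le.1 (hk k))) rep hiL k
    · refine lt_of_le_of_lt (Finset.card_le_card fun j hj => ?_) (not_le.1 (hi i).1.1)
      obtain ⟨-, h1, h2⟩ := Finset.mem_filter.1 hj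
      refine Finset.mem_filter.2 ⟨Finset.mem_univ _, h1, lt_of_le_of_lt ?_ h2⟩
      exact_mod_cast meetCount_le_card_obsTimes ht (i : R) j ω
    · refine lt_of_le_of_lt (Finset.card_le_card fun j hj => ?_) (not_le.1 (hi i).1.2)
      simp only [Finset.mem_filter, Finset.mem_univ, true_and] at hj
      obtain ⟨h1, h2⟩ := hj
      refine Finset.mem_filter.2 ⟨Finset.mem_univ _, h1, ?_⟩
      rw [meetCount_eq_zero ht h2]
      exact_mod_cast hn0
  have hcardU : ∀ (U : Finset (ObsPair L)) (f : ObsPair L → R), Set.InjOn f U → U.card ≤ N :=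
    fun U f hf => hN ▸ Finset.card_le_card_of_injOn f (fun _ _ => Finset.mem_univ _) hf
  have hMle : ∀ U : Finset (ObsPair L), U.card ≤ N → μ.real (M U) ≤ r ^ 3 := fun U hU =>
    hX.measure_many_misjudge_le hN hL hε hδ hδ1 τ U hU
  have hU₁N : ∀ i, (U₁ i).card ≤ N := fun i => hcardU _ (fun p => p.1.2) fun p hp p' hp' h => by
    have h1 := (Finset.mem_filter.1 hp).2.1
    have h2 := (Finset.mem_filter.1 hp').2.1
    exact Subtype.ext (Prod.ext (h1.trans h2.symm) h)
  have hU₂N : ∀ i, (U₂ i).card ≤ N := fun i => hcardU _ (fun p => p.1.2) fun p hp p' hp' h => by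
    have h1 := (Finset.mem_filter.1 hp).2.1
    have h2 := (Finset.mem_filter.1 hp').2.1
    exact Subtype.ext (Prod.ext (h1.trans h2.symm) h)
  have hU₃N : ∀ k, (U₃ k).card ≤ N := fun k => hcardU _ (fun p => p.1.1) fun p hp p' hp' h => by
    have h1 := (Finset.mem_filter.1 hp).2
    have h2 := (Finset.mem_filter.1 hp').2
    exact Subtype.ext (Prod.ext h (h1.trans h2.symm))
  have hI : μ.real (⋃ i, (E₁ i ∪ E₂ i) ∪ (M (U₁ i) ∪ M (U₂ i))) ≤ N * (4 * r ^ 3) := by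
    refine (measureReal_iUnion_fintype_le _).trans ?_
    refine (Finset.sum_le_sum fun i _ => ?_).trans (b := ∑ _i : L, 4 * r ^ 3) ?_
    · have h1 := measureReal_union_le (μ := μ) (E₁ i ∪ E₂ i) (M (U₁ i) ∪ M (U₂ i))
      have h2 := measureReal_union_le (μ := μ) (E₁ i) (E₂ i)
      have h3 := measureReal_union_le (μ := μ) (M (U₁ i)) (M (U₂ i))
      have h4 : μ.real (E₁ i) ≤ r ^ 3 := hmeet 0 i
      have h5 : μ.real (E₂ i) ≤ r ^ 3 := hmeet τ i
      have h6 := hMle _ (hU₁N i)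
      have h7 := hMle _ (hU₂N i)
      linarith
    · rw [Finset.sum_const, nsmul_eq_mul, Finset.card_univ, Fintype.card_coe]
      exact mul_le_mul_of_nonneg_right hlNr (by positivity)
  have hK : μ.real (⋃ k, M (U₃ k)) ≤ N * r ^ 3 := by
    refine (measureReal_iUnion_fintype_le _).trans ?_
    refine (Finset.sum_le_sum fun k _ => hMle _ (hU₃N k)).trans_eq ?_
    rw [Finset.sum_const, nsmul_eq_mul, Finset.card_univ, hN]
  have h1 := measureReal_mono (μ := μ) hcover
  rw [probReal_univ] at h1
  have h2 := measureReal_union_le (μ := μ) good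
    ((⋃ i, (E₁ i ∪ E₂ i) ∪ (M (U₁ i) ∪ M (U₂ i))) ∪ ⋃ k, M (U₃ k))
  have h3 := measureReal_union_le (μ := μ) (⋃ i, (E₁ i ∪ E₂ i) ∪ (M (U₁ i) ∪ M (U₂ i)))
    (⋃ k, M (U₃ k))
  have h4 : N * (5 * r ^ 3) ≤ δ / N := by
    rw [le_div_iff₀ (by linarith)]
    have h5 : (N : ℝ) * (5 * r ^ 3) * N = 5 * (r * N) ^ 2 * r := by ring
    have h6 : r * N ≤ 1 / 10 := by
      rw [hrN, div_le_iff₀ (by linarith)]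
      linarith
    have h7 : r ≤ δ := by
      rw [hr]
      exact div_le_self hδ.le (by nlinarith)
    have h8 : (r * N) ^ 2 ≤ (1 / 10) ^ 2 := pow_le_pow_left₀ (by positivity) h6 2
    rw [h5]
    nlinarith
  linarith

/-- Phases of the order of the hitting time: failures of different robots `j` are independent given
the path of `i`. -/
lemma meetsOften_hit [Nontrivial V] (hG : G.Connected) {N : ℕ} (hN : Fintype.card R = N)
    (hL : L.Nonempty) (hε : 0 < ε) (hε' : ε ≤ 1 / 2) (hδ : 0 < δ) (hδ1 : δ ≤ 1) {w : ℕ}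
    (hw : 640 / ε ^ 2 * Real.log (1 / qVal δ N L.card) ≤ w) :
    MeetsOften μ L χ (hitWindow G * w) (nAlpha ε δ N L.card) ((δ / (slack * N)) ^ 3) := by
  classical
  have hs := ten_le_slack
  have hl1 : 1 ≤ L.card := hL.card_pos
  have hlN : L.card ≤ N := hN ▸ L.card_le_univ
  have hN0 : (0 : ℝ) < N := by exact_mod_cast hl1.trans hlN
  have hlr : (0 : ℝ) < L.card := by exact_mod_cast hl1
  have hlNr : (L.card : ℝ) ≤ N := by exact_mod_cast hlN
  set r := δ / (slack * N) with hr
  have hr0 : 0 < r := by positivity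
  have hrN : r * N ≤ 1 / slack := by
    rw [hr, div_mul_eq_mul_div, mul_div_mul_right _ _ hN0.ne']
    exact div_le_div_of_nonneg_right hδ1 (by linarith)
  have hq1 : r * L.card ≤ 1 := ((mul_le_mul_of_nonneg_left hlNr hr0.le).trans hrN).trans
    ((div_le_one (by linarith)).2 (by linarith))
  have hp : 2 ^ nAlpha ε δ N L.card * (7 / 8 : ℝ) ^ w ≤ (r * L.card) ^ 25 := by
    rw [qVal_eq] at hw
    rw [nAlpha_eq, qVal_eq]
    refine two_rpow_mul_pow_le hε hε' (by positivity) hq1 le_rfl (le_of_eq_of_le ?_ hw)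
    ring
  intro s i
  have h1 := measure_card_ge_le (μ := μ) (Finset.univ.erase i)
    (fun j ω => (meetCount χ s (hitWindow G * w) i j ω : ℝ) < nAlpha ε δ N L.card)
    (failBound L.card) (p := 2 ^ nAlpha ε δ N L.card * (7 / 8 : ℝ) ^ w) fun J hJ hJc => by
      rw [← hJc]
      exact hX.measure_few_meetings_hit hG s w i (fun h => by simpa using hJ h) _
  have h2 : ∀ ω, (Finset.univ.filter fun j : L =>
      j ≠ i ∧ (meetCount χ s (hitWindow G * w) i j ω : ℝ) < nAlpha ε δ N L.card) =
      (Finset.univ.erase i).filter fun j : L =>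
        (meetCount χ s (hitWindow G * w) i j ω : ℝ) < nAlpha ε δ N L.card := by
    intro ω
    ext j
    simp
  simp only [h2]
  refine h1.trans (le_trans ?_ (choose_mul_pow_le (m := failBound L.card) hl1 (hl1.trans hlN)
    (by unfold failBound; omega) hr0.le hrN hlN (by positivity) hp))
  refine mul_le_mul_of_nonneg_right ?_ (by positivity)
  have : (Finset.univ.erase i).card ≤ N :=
    (Finset.card_le_univ _).trans (by rw [Fintype.card_coe]; exact hlN)
  exact_mod_cast Nat.choose_le_choose _ this

/-- Phases of the order of the meeting time: a union bound over all robots `j`. -/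
lemma meetsOften_meet [Nontrivial V] (hG : G.Connected) {N : ℕ} (hN : Fintype.card R = N)
    (hL : L.Nonempty) (hε : 0 < ε) (hε' : ε ≤ 1 / 2) (hδ : 0 < δ) (hδ1 : δ ≤ 1) {w : ℕ}
    (hw : 640 / ε ^ 2 * Real.log (1 / (δ / (slack * N))) ≤ w) :
    MeetsOften μ L χ (meetWindow G * w) (nAlpha ε δ N L.card) ((δ / (slack * N)) ^ 3) := by
  classical
  have hs := ten_le_slack
  have hl1 : 1 ≤ L.card := hL.card_pos
  have hlN : L.card ≤ N := hN ▸ L.card_le_univ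
  have hN0 : (0 : ℝ) < N := by exact_mod_cast hl1.trans hlN
  have hN1 : (1 : ℝ) ≤ N := by exact_mod_cast hl1.trans hlN
  have hlr : (1 : ℝ) ≤ L.card := by exact_mod_cast hl1
  set r := δ / (slack * N) with hr
  have hr0 : 0 < r := by positivity
  have hrN : r * N ≤ 1 := by
    rw [hr, div_mul_eq_mul_div, mul_div_mul_right _ _ hN0.ne', div_le_one (by linarith)]
    linarith
  have hr1 : r ≤ 1 := by nlinarith
  have hn : nAlpha ε δ N L.card ≤ 80 / ε ^ 2 * Real.log (1 / r) := by
    rw [nAlpha_eq, qVal_eq, ← hr]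
    refine mul_le_mul_of_nonneg_left ?_ (by positivity)
    refine Real.log_le_log (by positivity) (one_div_le_one_div_of_le hr0 ?_)
    exact le_mul_of_one_le_right hr0.le hlr
  have hp : 2 ^ nAlpha ε δ N L.card * (7 / 8 : ℝ) ^ w ≤ r ^ 25 := by
    refine two_rpow_mul_pow_le hε hε' hr0 hr1 hn (le_of_eq_of_le ?_ hw)
    ring
  intro s i
  have hsub : {ω | failBound L.card ≤ (Finset.univ.filter fun j : L =>
      j ≠ i ∧ (meetCount χ s (meetWindow G * w) i j ω : ℝ) < nAlpha ε δ N L.card).card} ⊆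
      ⋃ j ∈ (Finset.univ.erase i : Finset L),
        {ω | (meetCount χ s (meetWindow G * w) i j ω : ℝ) < nAlpha ε δ N L.card} := by
    intro ω hω
    have h1 : 0 < (Finset.univ.filter fun j : L =>
        j ≠ i ∧ (meetCount χ s (meetWindow G * w) i j ω : ℝ) < nAlpha ε δ N L.card).card :=
      lt_of_lt_of_le (by unfold failBound; omega) hω
    obtain ⟨j, hj⟩ := Finset.card_pos.1 h1
    obtain ⟨-, h2, h3⟩ := Finset.mem_filter.1 hj
    exact Set.mem_iUnion₂.2 ⟨j, by simpa using h2, h3⟩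
  refine (measureReal_mono hsub (measure_ne_top _ _)).trans
    ((measureReal_biUnion_finset_le _ _).trans ?_)
  refine (Finset.sum_le_sum fun j hj => (hX.measure_few_meetings_meet hG s w
    (Finset.ne_of_mem_erase hj).symm _).trans hp).trans ?_
  rw [Finset.sum_const, nsmul_eq_mul]
  have h1 : ((Finset.univ.erase i).card : ℝ) ≤ N := by
    have : (Finset.univ.erase i).card ≤ N :=
      (Finset.card_le_univ _).trans (by rw [Fintype.card_coe]; exact hlN)
    exact_mod_cast this
  calc ((Finset.univ.erase i).card : ℝ) * r ^ 25 ≤ N * r ^ 25 :=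
        mul_le_mul_of_nonneg_right h1 (by positivity)
    _ = (r * N) * r ^ 24 := by ring
    _ ≤ r ^ 24 := mul_le_of_le_one_left (by positivity) hrN
    _ ≤ r ^ 3 := pow_le_pow_of_le_one hr0.le hr1 (by norm_num)

end IsTeamProcess

end Failure

/-! ### The length of the phases -/

section Length

variable {V : Type*} [Fintype V] [Nontrivial V] {G : SimpleGraph V}

/-- The number of windows used for the failure level `x`; it is `8` times the number
`80 / ε ^ 2 * log (1 / x)`, which equals `n_α` for `x = q`. -/
noncomputable def windowCount (ε x : ℝ) : ℕ := ⌈640 / ε ^ 2 * Real.log (1 / x)⌉₊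

/-- A phase of `windowCount ε x` windows of length at most `20 * T`, where `1 / x` is
`slack * y`; the constant is `51200 = 2 * 20 * 1280`, where `1280` is `640` doubled to absorb the
ceiling. The condition `δ ≤ δ₀ < 1` keeps `log y` away from zero, so that it absorbs
`log slack`. -/
lemma two_mul_phase_le {δ₀ ε x y T : ℝ} {W : ℕ} (hδ₀ : 0 < δ₀) (hδ₀' : δ₀ < 1) (hε : 0 < ε)
    (hε' : ε ≤ 1 / 2) (hx : 1 / x = slack * y) (hy : 1 / δ₀ ≤ y) (hT : 0 ≤ T)
    (hW : (W : ℝ) ≤ 20 * T) :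
    2 * ((W * windowCount ε x : ℕ) : ℝ) ≤
      51200 * (1 + Real.log slack / Real.log (1 / δ₀)) / ε ^ 2 * (T * Real.log y) := by
  have hs := ten_le_slack
  have hy1 : 1 < y := (one_lt_one_div hδ₀ hδ₀').trans_le hy
  have hb : 0 < Real.log (1 / δ₀) := Real.log_pos (one_lt_one_div hδ₀ hδ₀')
  have hby : Real.log (1 / δ₀) ≤ Real.log y := Real.log_le_log (by positivity) hy
  have hls : 1 ≤ Real.log slack := by
    rw [Real.le_log_iff_exp_le (by linarith)]
    linarith [Real.exp_one_lt_d9]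
  have hlx : Real.log (1 / x) = Real.log slack + Real.log y := by
    rw [hx, Real.log_mul (by linarith) (by linarith)]
  have hε2 : 1 ≤ 1 / ε ^ 2 := by
    rw [le_div_iff₀ (by positivity)]
    nlinarith
  have h1 : Real.log (1 / x) ≤ (1 + Real.log slack / Real.log (1 / δ₀)) * Real.log y := by
    have : Real.log slack ≤ Real.log slack / Real.log (1 / δ₀) * Real.log y := by
      rw [div_mul_eq_mul_div, le_div_iff₀ hb]
      exact mul_le_mul_of_nonneg_left hby (by linarith)
    rw [hlx]
    linarith
  have h2 : (windowCount ε x : ℝ) ≤ 1280 * (1 / ε ^ 2) * Real.log (1 / x) := by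
    have h3 : 1 ≤ (1 / ε ^ 2) * Real.log (1 / x) :=
      one_le_mul_of_one_le_of_one_le hε2 (by linarith)
    have h4 : 640 / ε ^ 2 * Real.log (1 / x) = 640 * ((1 / ε ^ 2) * Real.log (1 / x)) := by ring
    have h5 := (Nat.ceil_lt_add_one (a := 640 / ε ^ 2 * Real.log (1 / x)) (by linarith)).le
    rw [windowCount]
    linarith
  have h6 := h2.trans (mul_le_mul_of_nonneg_left h1 (by positivity))
  have h7 := mul_le_mul hW h6 (Nat.cast_nonneg _) (by positivity)
  push_cast
  refine (mul_le_mul_of_nonneg_left h7 two_pos.le).trans_eq ?_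
  ring

lemma hitWindow_le (hG : G.Connected) : (hitWindow G : ℝ) ≤ 20 * (hitTime G).toReal := by
  have hT := one_le_hitTime hG
  have h1 := (Nat.ceil_lt_add_one (a := 16 * (hitTime G).toReal) (by linarith)).le
  have h2 := (Nat.ceil_lt_add_one (a := (hitTime G).toReal) (by linarith)).le
  unfold hitWindow
  push_cast
  linarith

lemma meetWindow_le (hG : G.Connected) : (meetWindow G : ℝ) ≤ 20 * (meetTime G).toReal := by
  have hT := one_le_meetTime hG
  have h1 := (Nat.ceil_lt_add_one (a := 2 * (meetTime G).toReal) (by linarith)).le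
  unfold meetWindow
  linarith

end Length

end CrowdVetting

theorem theorem2 (δ₀ : ℝ) (hδ₀ : 0 < δ₀) (hδ₀' : δ₀ < 1) :
    ∃ (C : ℝ) (C' : ℝ → ℝ),
      ∀ (nV : ℕ) (G : SimpleGraph (Fin nV)), 2 ≤ nV → G.Connected →
      ∀ (ε δ : ℝ), 0 < ε → ε ≤ 1 / 2 → 0 < δ → δ ≤ δ₀ →
      ∀ (nR l : ℕ), 1 ≤ l → l ≤ nR →
      ∃ τ₀ : ℕ,
        -- the running time `2 τ₀` of the two phases
        2 * (τ₀ : ℝ) ≤ C / ε ^ 2 *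
          min ((CrowdVetting.hitTime G).toReal * Real.log ((nR : ℝ) / (δ * (l : ℝ))))
            ((CrowdVetting.meetTime G).toReal * Real.log ((nR : ℝ) / δ)) ∧
        -- no growth with the team size if there are at most `K * l` malicious robots
        (∀ K : ℝ, (nR : ℝ) - (l : ℝ) ≤ K * (l : ℝ) →
          2 * (τ₀ : ℝ) ≤ C' K / ε ^ 2 * ((CrowdVetting.hitTime G).toReal * Real.log (1 / δ))) ∧
        -- correctness, for phases of any length `τ ≥ τ₀` and whatever the malicious robots report
        ∀ τ : ℕ, τ₀ ≤ τ →
        ∀ (L : Finset (Fin nR)), L.card = l →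
        ∀ (Ω : Type*) [MeasurableSpace Ω] (μ : MeasureTheory.Measure Ω)
          [MeasureTheory.IsProbabilityMeasure μ]
          (χ : ℕ → Fin nR → Ω → Fin nV) (α : ℕ → Fin nR → Fin nR → Ω → ℝ),
          CrowdVetting.IsTeamProcess μ G L ε χ α →
          1 - δ / (nR : ℝ) ≤
            μ.real {ω | ∀ (rep : Fin nR → Fin nR → Fin nR → Bool), ∀ i ∈ L, ∀ k : Fin nR,
              CrowdVetting.finalTrust L (fun t r => χ t r ω) (fun t r r' => α t r r' ω) τ
                (CrowdVetting.nAlpha ε δ nR l) rep i k = true ↔ k ∈ L} := by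
  set D := 51200 * (1 + Real.log CrowdVetting.slack / Real.log (1 / δ₀)) with hD
  have hb : 0 < Real.log (1 / δ₀) := Real.log_pos (one_lt_one_div hδ₀ hδ₀')
  have hs := CrowdVetting.ten_le_slack
  have hD0 : 0 ≤ D := by
    have := Real.log_nonneg (by linarith : (1 : ℝ) ≤ CrowdVetting.slack)
    positivity
  refine ⟨D, fun K => D * (1 + Real.log (1 + |K|) / Real.log (1 / δ₀)), ?_⟩
  intro nV G hV hG ε δ hε hε' hδ hδ' nR l hl hlR
  have : Nontrivial (Fin nV) := Fin.nontrivial_iff_two_le.2 hV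
  have hδ1 : δ ≤ 1 := hδ'.trans hδ₀'.le
  have hlr : (1 : ℝ) ≤ l := by exact_mod_cast hl
  have hlR' : (l : ℝ) ≤ nR := by exact_mod_cast hlR
  have hR0 : (0 : ℝ) < nR := by linarith
  have hTh := CrowdVetting.one_le_hitTime hG
  have hTm := CrowdVetting.one_le_meetTime hG
  have hδδ : 1 / δ₀ ≤ 1 / δ := one_div_le_one_div_of_le hδ hδ'
  set w₁ := CrowdVetting.windowCount ε (CrowdVetting.qVal δ nR l) with hw₁
  set w₂ := CrowdVetting.windowCount ε (δ / (CrowdVetting.slack * nR)) with hw₂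
  -- the two candidates for the length of a phase; the shorter one is taken
  set t₁ := CrowdVetting.hitWindow G * w₁ with ht₁
  set t₂ := CrowdVetting.meetWindow G * w₂ with ht₂
  have hq : 1 / δ ≤ (nR : ℝ) / (δ * l) := by
    rw [div_le_div_iff₀ hδ (by positivity)]
    nlinarith
  have hr : 1 / δ ≤ (nR : ℝ) / δ := div_le_div_of_nonneg_right (by linarith) hδ.le
  have h₁ : 2 * (t₁ : ℝ) ≤ D / ε ^ 2 *
      ((CrowdVetting.hitTime G).toReal * Real.log ((nR : ℝ) / (δ * l))) := by
    refine CrowdVetting.two_mul_phase_le hδ₀ hδ₀' hε hε' ?_ (hδδ.trans hq) (by linarith)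
      (CrowdVetting.hitWindow_le hG)
    rw [CrowdVetting.qVal_eq]
    field_simp
  have h₂ : 2 * (t₂ : ℝ) ≤ D / ε ^ 2 *
      ((CrowdVetting.meetTime G).toReal * Real.log ((nR : ℝ) / δ)) := by
    refine CrowdVetting.two_mul_phase_le hδ₀ hδ₀' hε hε' ?_ (hδδ.trans hr) (by linarith)
      (CrowdVetting.meetWindow_le hG)
    field_simp
  have hmin₁ : 2 * ((min t₁ t₂ : ℕ) : ℝ) ≤ 2 * (t₁ : ℝ) := by
    have : ((min t₁ t₂ : ℕ) : ℝ) ≤ t₁ := by exact_mod_cast min_le_left t₁ t₂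
    linarith
  have hmin₂ : 2 * ((min t₁ t₂ : ℕ) : ℝ) ≤ 2 * (t₂ : ℝ) := by
    have : ((min t₁ t₂ : ℕ) : ℝ) ≤ t₂ := by exact_mod_cast min_le_right t₁ t₂
    linarith
  refine ⟨min t₁ t₂, ?_, fun K hK => ?_, ?_⟩
  · rw [mul_min_of_nonneg _ _ (by positivity)]
    exact le_min (hmin₁.trans h₁) (hmin₂.trans h₂)
  · refine (hmin₁.trans h₁).trans ?_
    have hKa : 0 ≤ |K| := abs_nonneg K
    have hlogK : 0 ≤ Real.log (1 + |K|) := Real.log_nonneg (by linarith)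
    have hbδ : Real.log (1 / δ₀) ≤ Real.log (1 / δ) := Real.log_le_log (by positivity) hδδ
    have h3 : Real.log ((nR : ℝ) / (δ * l)) ≤
        (1 + Real.log (1 + |K|) / Real.log (1 / δ₀)) * Real.log (1 / δ) := by
      have h4 : (nR : ℝ) / (δ * l) ≤ (1 + |K|) * (1 / δ) := by
        rw [mul_one_div, div_le_div_iff₀ (by positivity) hδ]
        have h5 : K * l ≤ |K| * l := mul_le_mul_of_nonneg_right (le_abs_self K) (by linarith)
        have h6 : (nR : ℝ) ≤ (1 + |K|) * l := by linarith
        nlinarith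
      have h7 := Real.log_le_log (by positivity) h4
      rw [Real.log_mul (by positivity) (by positivity)] at h7
      have h8 : Real.log (1 + |K|) ≤
          Real.log (1 + |K|) / Real.log (1 / δ₀) * Real.log (1 / δ) := by
        rw [div_mul_eq_mul_div, le_div_iff₀ hb]
        exact mul_le_mul_of_nonneg_left hbδ hlogK
      linarith
    calc D / ε ^ 2 * ((CrowdVetting.hitTime G).toReal * Real.log ((nR : ℝ) / (δ * l)))
        ≤ D / ε ^ 2 * ((CrowdVetting.hitTime G).toReal *
          ((1 + Real.log (1 + |K|) / Real.log (1 / δ₀)) * Real.log (1 / δ))) := by gcongr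
      _ = _ := by ring
  · intro τ hτ L hL Ω _ μ _ χ α hX
    have hLne : L.Nonempty := Finset.card_pos.1 (by omega)
    have hN : Fintype.card (Fin nR) = nR := Fintype.card_fin nR
    subst hL
    rcases le_total t₁ t₂ with h | h
    · rw [min_eq_left h] at hτ
      exact hX.measure_correct_ge hN hLne hε hδ hδ1 hτ
        (hX.meetsOften_hit hG hN hLne hε hε' hδ hδ1 (Nat.le_ceil _))
    · rw [min_eq_right h] at hτ
      exact hX.measure_correct_ge hN hLne hε hδ hδ1 hτ
        (hX.meetsOften_meet hG hN hLne hε hε' hδ hδ1 (Nat.le_ceil _))
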